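/- Work on the triangular lattice with horizontal lattice lines and unit edges. A lozenge is the union of two unit triangles sharing an edge; a lozenge tiling of a region (a finite union of unit triangles) is a covering of it by lozenges contained in it, without gaps or overlaps. If the lozenges carry weights, the weight of a tiling is the product of the weights of its lozenges, and $\operatorname{M}(R)$ is the sum of the weights of all tilings of $R$. For real $x$ and integers $n,m$ put (empty products being $1$) $$(x)_n=\begin{cases}\prod_{i=0}^{n-1}(x+i)& n\ge 0\\ \prod_{i=1}^{-n}(x-i)^{-1}& n<0\end{cases},\qquad [x]_n=\begin{cases}\prod_{i=0}^{n-1}(x+2i)& n\ge 0\\ \prod_{i=1}^{-n}(x-2i)^{-1}& n<0\end{cases},$$ $$\operatorname{T}(x,n,m)=\prod_{i=0}^{m-1}(x+i)_{n-2i},\qquad \operatorname{V}(x,n,m)=\prod_{i=0}^{m-1}[x+2i]_{n-2i}\qquad(m\ge 0),$$ and $\operatorname{T}(x,n,m)=\operatorname{T}(x,n,-m)^{-1}$, $\operatorname{V}(x,n,m)=\operatorname{V}(x,n,-m)^{-1}$ for $m<0$. For non-negative integers $a\le b$ and $c$, let $P'_{a,b,c}$ be the hexagon with side lengths $a,b,c,a,b,c$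 (counterclockwise, starting with the northwestern side) from which all unit triangles lying entirely to the left of the vertical line through the western end of the northern side are removed. So its western boundary contains a zigzag, running along the $2a$ unit triangles bisected by that line; each (vertical) lozenge consisting of two of these triangles has weight $\frac12$, and all other lozenges have weight $1$. For non-negative integers $x,a,b,c$, let $B'_{x,a,b,c}$ be the following weighted region. Let $\ell$ be a vertical line through lattice points and let $O$ be a lattice point on $\ell$. Start with the halved hexagon which consists of all unit triangles bisected by $\ell$ or lying to the right of $\ell$ in the region bounded as follows: from $O$ go $b$ unit steps southeast, $x$ east, $2a+c$ northeast, $b+c$ northwest, $x+a$ west (arriving on $\ell$, $2(a+c)$ rows above $O$), and return to $O$ along $\ell$. (Its northern, northeastern, southeastern and southern sides have lengths $x+a,\ b+c,\ 2a+c,\ x$; if $a+c>0$, its southwestern side has length $b+1$ and its western side is a zigzag along the $2(a+c)$ unit triangles bisected by $\ell$, sharing its lowest edge with the southwestern side.) Remove from it all unit triangles contained in the down-pointing triangle of side $2a$ that has its bottom vertex at $O$ and is symmetric about $\ell$. Each vertical lozenge consisting of two unit triangles bisected by $\ell$ has weight $\frac12$; all other lozenges have weight $1$. **Theorem.** For all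 non-negative integers $x,a,b,c$, with $h=\lfloor\frac{c+1}{2}\rfloor$, $$\operatorname{M}(B'_{x,a,b,c})=\operatorname{M}(P'_{c,c,a})\,\frac{\operatorname{V}(2x+2a+b+2,c-1,h)}{\operatorname{V}(2a+b+2,c-1,h)}\cdot\frac{\operatorname{T}(x+1,2a+b+c-1,b)\,\operatorname{T}(x+a+\frac{b+1}{2},c,h)}{\operatorname{T}(1,2a+b+c-1,b)\,\operatorname{T}(a+\frac{b+1}{2},c,h)}$$ if $b$ is odd, and $$\operatorname{M}(B'_{x,a,b,c})=\operatorname{M}(P'_{c,c,a})\,\frac{\operatorname{V}(2x+2a+b+1,c,h)}{\operatorname{V}(2a+b+1,c,h)}\cdot\frac{\operatorname{T}(x+1,2a+b+c-1,b)\,\operatorname{T}(x+a+\frac{b+2}{2},c-1,h)}{\operatorname{T}(1,2a+b+c-1,b)\,\operatorname{T}(a+\frac{b+2}{2},c-1,h)}$$ if $b$ is even. -/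

import Mathlib

namespace ZigzagTiling

/-! Unit triangles of the triangular lattice (with horizontal lattice lines).

The lattice is cut into horizontal rows of height `√3/2`; row `r` lies between the heights
`r * √3/2` and `(r+1) * √3/2`.  The unit triangle `(r, k)` is the one lying in row `r` whose
vertical symmetry axis is the line `X = k/2`.  It is down-pointing if `r + k` is even
(vertices `(k/2, r)`, `((k-1)/2, r+1)`, `((k+1)/2, r+1)`, the second coordinate being counted in
rows) and up-pointing if `r + k` is odd (vertices `((k-1)/2, r)`, `((k+1)/2, r)`, `(k/2, r+1)`).
In particular the origin is a lattice point, and the unit triangles bisected by the vertical line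
through the origin are those with `k = 0`. -/

/-- A unit triangle `(r, k)`: row `r`, symmetry axis `X = k/2`. -/
abbrev Tri : Type := ℤ × ℤ

/-- `Below s t`: `s` is a down-pointing triangle and `t` is the up-pointing triangle that shares
the horizontal top edge of `s`. -/
def Below (s t : Tri) : Prop :=
  Even (s.1 + s.2) ∧ t.1 = s.1 + 1 ∧ t.2 = s.2

/-- Two unit triangles share an edge: they are neighbours in the same row, or they share a
horizontal edge. -/
def ShareEdge (s t : Tri) : Prop :=
  (s.1 = t.1 ∧ (t.2 = s.2 + 1 ∨ s.2 = t.2 + 1)) ∨ Below s t ∨ Below t s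

/-- A lozenge: the union of two unit triangles sharing an edge, as the set of these triangles. -/
def IsLozenge (l : Finset Tri) : Prop :=
  ∃ s t : Tri, ShareEdge s t ∧ l = {s, t}

open Classical in
/-- The lozenge tilings of a region `R` (a finite set of unit triangles): the sets of lozenges
contained in `R` such that every unit triangle of `R` lies in exactly one of them. -/
noncomputable def tilings (R : Finset Tri) : Finset (Finset (Finset Tri)) :=
  R.powerset.powerset.filter fun 𝒯 =>
    (∀ l ∈ 𝒯, IsLozenge l) ∧ ∀ t ∈ R, ∃! l, l ∈ 𝒯 ∧ t ∈ l

/-- `M(R)` for a region `R` whose lozenges carry the weights `w`: the sum over all tilings of the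
product of the weights of the lozenges in the tiling. -/
noncomputable def weightedCount (R : Finset Tri) (w : Finset Tri → ℚ) : ℚ :=
  ∑ 𝒯 ∈ tilings R, ∏ l ∈ 𝒯, w l

/-- All the regions below are situated so that the unit triangles along their western zigzag
are triangles `(r, 0)`, the region lying to the right of the line `X = -1/2`.  The lozenges formed
by two such triangles are exactly the vertical lozenges along the zigzag; they have weight `1/2`,
all other lozenges have weight `1`. -/
def zigzagWeight (l : Finset Tri) : ℚ :=
  if ∀ t ∈ l, t.2 = 0 then 1 / 2 else 1

/-- The semi-regular hexagon with sides `a, b, c, a, b, c` in counterclockwise order starting from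
the northwestern side, for `a ≤ b` (so: northwestern `a`, southwestern `b`, southern `c`,
southeastern `a`, northeastern `b`, northern `c`).  The western end of the northern side
is the lattice point at height `2 * a` on the vertical line through the origin. -/
noncomputable def hexagon (a b c : ℕ) : Finset Tri :=
  (Finset.Ico (a - b : ℤ) (2 * a) ×ˢ Finset.Icc (-a : ℤ) (2 * a + 2 * b + 2 * c)).filter fun t =>
    -t.1 ≤ t.2 ∧                       -- right of the southwestern side
    t.1 - 2 * a + 1 ≤ t.2 ∧            -- right of the northwestern side
    t.2 ≤ 2 * (b - a) + 2 * c + t.1 ∧  -- left of the southeastern side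
    t.2 ≤ 2 * c + 2 * a - 1 - t.1      -- left of the northeastern side

/-- The region `P'_{a,b,c}` for `a ≤ b` (to be used with `zigzagWeight`): the hexagon with its
maximal staircase cut off, i.e. without the triangles entirely to the left of the vertical line
through the western end of the northern side. -/
noncomputable def regionP' (a b c : ℕ) : Finset Tri :=
  (hexagon a b c).filter fun t => 0 ≤ t.2

/-- The halved hexagon whose northern, northeastern, southeastern, southern and southwestern sides
have lengths `x + a`, `b + c`, `2 * a + c`, `x`, `b + 1`, and whose western side is a zigzag path of
`a + c` steps (each step consisting of two unit edges, the first unit edge from the bottom being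
also the topmost edge of the southwestern side).  The zigzag consists of the left edges
of the triangles `(r, 0)` with `0 ≤ r < 2 * (a + c)`. -/
noncomputable def halvedHexagon (x a b c : ℕ) : Finset Tri :=
  (Finset.Ico (-b : ℤ) (2 * a + 2 * c) ×ˢ
      Finset.Icc (0 : ℤ) (2 * x + 4 * a + b + 2 * c)).filter fun t =>
    -t.1 ≤ t.2 ∧                             -- right of the southwestern side
    t.2 ≤ 2 * x + 2 * b + t.1 ∧              -- left of the southeastern side
    t.2 ≤ 2 * x + 4 * a + 2 * c - 1 - t.1    -- left of the northeastern side

/-- The down-pointing triangle of side `n` whose bottom vertex is the origin, as a set of unit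
triangles: row `r` consists of the `2 * r + 1` triangles `(r, k)` with `|k| ≤ r`. -/
noncomputable def downTriangle (n : ℕ) : Finset Tri :=
  (Finset.Ico (0 : ℤ) n ×ˢ Finset.Icc (-n : ℤ) n).filter fun t => |t.2| ≤ t.1

/-- The region `B'_{x,a,b,c}` (to be used with `zigzagWeight`): the halved hexagon from which
(half of) a down-pointing triangle of side `2 * a`, placed at the bottom of the zigzag and symmetric
about the vertical axis through the origin, has been removed. -/
noncomputable def regionB' (x a b c : ℕ) : Finset Tri :=
  halvedHexagon x a b c \ downTriangle (2 * a)

/-- The Pochhammer symbol `(x)_n` for an integer `n`. -/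
def poch (x : ℚ) (n : ℤ) : ℚ :=
  if 0 ≤ n then ∏ i ∈ Finset.range n.toNat, (x + i)
  else 1 / ∏ i ∈ Finset.range (-n).toNat, (x - (i + 1))

/-- The skipped Pochhammer symbol `[x]_n` for an integer `n`. -/
def skipPoch (x : ℚ) (n : ℤ) : ℚ :=
  if 0 ≤ n then ∏ i ∈ Finset.range n.toNat, (x + 2 * i)
  else 1 / ∏ i ∈ Finset.range (-n).toNat, (x - 2 * (i + 1))

/-- The trapezoidal product `T(x, n, m)`. -/
def T (x : ℚ) (n m : ℤ) : ℚ :=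
  if 0 ≤ m then ∏ i ∈ Finset.range m.toNat, poch (x + i) (n - 2 * i)
  else (∏ i ∈ Finset.range (-m).toNat, poch (x + i) (n - 2 * i))⁻¹

/-- The trapezoidal product `V(x, n, m)`. -/
def V (x : ℚ) (n m : ℤ) : ℚ :=
  if 0 ≤ m then ∏ i ∈ Finset.range m.toNat, skipPoch (x + 2 * i) (n - 2 * i)
  else (∏ i ∈ Finset.range (-m).toNat, skipPoch (x + 2 * i) (n - 2 * i))⁻¹

end ZigzagTiling

namespace ZigzagTiling

/-! The lozenges with two sides parallel to the northeastern boundary form non-intersecting paths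
from the western boundary to the northeastern side: `b` of them start on the southwestern side and
`c` on the zigzag. So the weighted count is a determinant of weighted numbers of paths
(`PathVectors.weightedCount_eq`, `weightedCount_regionB'`). This is proved by removing one triangle
after another: the choice between two lozenges is linearity of the determinant in one row, and
colliding paths give two equal rows.

The determinant is then evaluated as a function of `x`. After multiplication by a Pascal matrix, the
`l`-th column depends on `M = x + a + l` only: the zigzag rows are odd polynomials in `M + 1/2`,
thanks to the weight `1/2`, and the other rows share the factor `colFactor`. Once this factor is
divided out, the latter are polynomials of degree less than `b` in `l`. Hence `b`-th differences of
the first `c` columns make the matrix block triangular (`det_reducedEntry_mul`). One diagonal block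
is a Vandermonde determinant free of `x`; row operations and an explicit difference formula turn the
other into a Vandermonde determinant in the squares of `symPos` (`det_reducedEntry_left`).

This gives the determinant up to a factor `K` free of `x`. Dividing by `colFactor` requires `c ≤ x`,
but the resulting identity is polynomial in `x` and so holds for all `x`
(`det_tilingMatrix_formula`). At `x = 0` the paths from the southwestern side are forced, which
leaves the determinant of `P'_{c,c,a}` and fixes `K` (`det_tilingMatrix_zero`). Finally the products
are regrouped into `T` and `V`, up to constants that cancel between `x` and `0`. -/

/-! ### Lozenge tilings and removal of one lozenge -/

theorem ShareEdge.symm {s t : Tri} (h : ShareEdge s t) : ShareEdge t s := by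
  rcases h with ⟨h, h'⟩ | h | h
  · exact Or.inl ⟨h.symm, h'.symm⟩
  · exact Or.inr (Or.inr h)
  · exact Or.inr (Or.inl h)

theorem ShareEdge.ne {s t : Tri} (h : ShareEdge s t) : s ≠ t := by
  rintro rfl
  rcases h with ⟨-, h | h⟩ | ⟨-, h, -⟩ | ⟨-, h, -⟩ <;> omega

theorem IsLozenge.eq_pair {l : Finset Tri} (h : IsLozenge l) {t : Tri} (ht : t ∈ l) :
    ∃ s, ShareEdge t s ∧ l = {t, s} := by
  obtain ⟨u, v, huv, rfl⟩ := h
  rcases Finset.mem_insert.1 ht with rfl | ht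
  · exact ⟨v, huv, rfl⟩
  · rw [Finset.mem_singleton] at ht
    subst ht
    exact ⟨u, huv.symm, Finset.pair_comm _ _⟩

theorem mem_tilings {R : Finset Tri} {𝒯 : Finset (Finset Tri)} :
    𝒯 ∈ tilings R ↔ (∀ l ∈ 𝒯, l ⊆ R) ∧ (∀ l ∈ 𝒯, IsLozenge l) ∧
      ∀ t ∈ R, ∃! l, l ∈ 𝒯 ∧ t ∈ l := by
  simp only [tilings, Finset.mem_filter, Finset.mem_powerset]
  refine and_congr_left fun _ => ?_
  simp only [Finset.subset_iff (s₁ := 𝒯), Finset.mem_powerset]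

theorem weightedCount_empty (w : Finset Tri → ℚ) : weightedCount ∅ w = 1 := by
  have : tilings ∅ = {∅} := by
    ext 𝒯
    rw [mem_tilings, Finset.mem_singleton]
    constructor
    · rintro ⟨h, h', -⟩
      refine Finset.eq_empty_of_forall_notMem fun l hl => ?_
      obtain ⟨s, t, -, e⟩ := h' l hl
      have := h l hl
      rw [e] at this
      exact absurd (this (Finset.mem_insert_self _ _)) (Finset.notMem_empty _)
    · rintro rfl
      simp
  simp [weightedCount, this]

theorem insert_mem_tilings {R : Finset Tri} {s t : Tri} (ht : t ∈ R) (hs : s ∈ R)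
    (hst : ShareEdge t s) {𝒯 : Finset (Finset Tri)} (h : 𝒯 ∈ tilings (R \ {t, s})) :
    insert {t, s} 𝒯 ∈ tilings R := by
  rw [mem_tilings] at h ⊢
  obtain ⟨h1, h2, h3⟩ := h
  have key : ∀ l ∈ 𝒯, ∀ u ∈ l, u ∈ R ∧ u ≠ t ∧ u ≠ s := by
    intro l hl u hu
    have := h1 l hl hu
    simpa using this
  refine ⟨?_, ?_, ?_⟩
  · intro l hl
    rcases Finset.mem_insert.1 hl with rfl | hl
    · intro u hu
      simp only [Finset.mem_insert, Finset.mem_singleton] at hu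
      rcases hu with rfl | rfl <;> assumption
    · exact fun u hu => (key l hl u hu).1
  · intro l hl
    rcases Finset.mem_insert.1 hl with rfl | hl
    · exact ⟨t, s, hst, rfl⟩
    · exact h2 l hl
  · intro u hu
    by_cases hu' : u = t ∨ u = s
    · refine ⟨{t, s}, ⟨Finset.mem_insert_self _ _, by simpa using hu'⟩, ?_⟩
      rintro l ⟨hl, hul⟩
      rcases Finset.mem_insert.1 hl with rfl | hl
      · rfl
      · have := key l hl u hul
        tauto
    · obtain ⟨l, ⟨hl, hul⟩, huniq⟩ := h3 u (by simp; tauto)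
      refine ⟨l, ⟨Finset.mem_insert_of_mem hl, hul⟩, ?_⟩
      rintro l' ⟨hl', hul'⟩
      rcases Finset.mem_insert.1 hl' with rfl | hl'
      · exact absurd (by simpa using hul') hu'
      · exact huniq l' ⟨hl', hul'⟩

theorem erase_mem_tilings {R : Finset Tri} {s t : Tri} {𝒯 : Finset (Finset Tri)}
    (h : 𝒯 ∈ tilings R) (hl : {t, s} ∈ 𝒯) :
    𝒯.erase {t, s} ∈ tilings (R \ {t, s}) := by
  rw [mem_tilings] at h ⊢
  obtain ⟨h1, h2, h3⟩ := h
  have disj : ∀ l ∈ 𝒯.erase {t, s}, ∀ u ∈ l, u ≠ t ∧ u ≠ s := by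
    intro l hl' u hu
    rw [Finset.mem_erase] at hl'
    have aux : ∀ u', u' ∈ ({t, s} : Finset Tri) → u ≠ u' := by
      rintro u' hu' rfl
      exact hl'.1 ((h3 u (h1 _ hl hu')).unique ⟨hl'.2, hu⟩ ⟨hl, hu'⟩)
    exact ⟨aux t (by simp), aux s (by simp)⟩
  refine ⟨?_, fun l hl' => h2 l (Finset.mem_of_mem_erase hl'), ?_⟩
  · intro l hl' u hu
    have := disj l hl' u hu
    have := h1 l (Finset.mem_of_mem_erase hl') hu
    simp; tauto
  · intro u hu
    simp only [Finset.mem_sdiff, Finset.mem_insert, Finset.mem_singleton] at hu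
    obtain ⟨l, ⟨hl', hul⟩, huniq⟩ := h3 u hu.1
    refine ⟨l, ⟨Finset.mem_erase.2 ⟨?_, hl'⟩, hul⟩, ?_⟩
    · rintro rfl
      exact hu.2 (by simpa using hul)
    · rintro l' ⟨hl'', hul'⟩
      exact huniq l' ⟨Finset.mem_of_mem_erase hl'', hul'⟩

open Classical in
/-- Expansion of the weighted count according to the lozenge covering a given triangle. -/
theorem weightedCount_peel (R : Finset Tri) (w : Finset Tri → ℚ) {t : Tri} (ht : t ∈ R) :
    weightedCount R w =
      ∑ s ∈ R.filter (ShareEdge t), w {t, s} * weightedCount (R \ {t, s}) w := by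
  simp only [weightedCount, Finset.mul_sum]
  rw [Finset.sum_sigma']
  symm
  refine Finset.sum_bij (fun p _ => insert {t, p.1} p.2) ?_ ?_ ?_ ?_
  · rintro ⟨s, 𝒯⟩ h
    simp only [Finset.mem_sigma, Finset.mem_filter] at h
    exact insert_mem_tilings ht h.1.1 h.1.2 h.2
  · rintro ⟨s, 𝒯⟩ h ⟨s', 𝒯'⟩ h' e
    simp only [Finset.mem_sigma, Finset.mem_filter] at h h'
    have nm : ∀ s (𝒯 : Finset (Finset Tri)), 𝒯 ∈ tilings (R \ {t, s}) → ∀ l ∈ 𝒯, t ∉ l := by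
      intro s 𝒯 h l hl hl'
      have := (mem_tilings.1 h).1 l hl hl'
      simp at this
    dsimp only at e
    have e1 : ({t, s} : Finset Tri) = {t, s'} := by
      have := Finset.mem_insert_self {t, s} 𝒯
      rw [e] at this
      rcases Finset.mem_insert.1 this with h1 | h1
      · exact h1
      · exact absurd (Finset.mem_insert_self _ _) (nm _ _ h'.2 _ h1)
    have e2 : s = s' := by
      have : s ∈ ({t, s'} : Finset Tri) := by rw [← e1]; simp
      simp only [Finset.mem_insert, Finset.mem_singleton] at this
      exact this.resolve_left h.1.2.ne.symm
    subst e2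
    have n1 : ({t, s} : Finset Tri) ∉ 𝒯 := fun h1 => nm _ _ h.2 _ h1 (by simp)
    have n2 : ({t, s} : Finset Tri) ∉ 𝒯' := fun h1 => nm _ _ h'.2 _ h1 (by simp)
    have : 𝒯 = 𝒯' := by
      rw [← Finset.erase_insert n1, e, Finset.erase_insert n2]
    rw [this]
  · intro 𝒯 h
    have h' := mem_tilings.1 h
    obtain ⟨l, ⟨hl, htl⟩, -⟩ := h'.2.2 t ht
    obtain ⟨s, hs, rfl⟩ := (h'.2.1 l hl).eq_pair htl
    refine ⟨⟨s, 𝒯.erase {t, s}⟩, ?_, Finset.insert_erase hl⟩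
    simp only [Finset.mem_sigma, Finset.mem_filter]
    exact ⟨⟨h'.1 _ hl (by simp), hs⟩, erase_mem_tilings h hl⟩
  · rintro ⟨s, 𝒯⟩ h
    simp only [Finset.mem_sigma, Finset.mem_filter] at h
    rw [Finset.prod_insert]
    intro h1
    have := (mem_tilings.1 h.2).1 _ h1 (Finset.mem_insert_self _ _)
    simp at this

theorem weightedCount_eq_zero (R : Finset Tri) (w : Finset Tri → ℚ) {t : Tri} (ht : t ∈ R)
    (h : ∀ s ∈ R, ¬ ShareEdge t s) : weightedCount R w = 0 := by
  classical
  rw [weightedCount_peel R w ht, Finset.filter_false_of_mem h, Finset.sum_empty]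

theorem weightedCount_forced (R : Finset Tri) (w : Finset Tri → ℚ) {t s : Tri} (ht : t ∈ R)
    (hs : s ∈ R) (hts : ShareEdge t s) (h : ∀ u ∈ R, ShareEdge t u → u = s) :
    weightedCount R w = w {t, s} * weightedCount (R \ {t, s}) w := by
  classical
  rw [weightedCount_peel R w ht]
  have : R.filter (ShareEdge t) = {s} := by
    ext u
    simp only [Finset.mem_filter, Finset.mem_singleton]
    exact ⟨fun hu => h u hu.1 hu.2, by rintro rfl; exact ⟨hs, hts⟩⟩
  rw [this, Finset.sum_singleton]

theorem weightedCount_two (R : Finset Tri) (w : Finset Tri → ℚ) {t s s' : Tri} (ht : t ∈ R)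
    (hs : s ∈ R) (hs' : s' ∈ R) (hne : s ≠ s') (hts : ShareEdge t s) (hts' : ShareEdge t s')
    (h : ∀ u ∈ R, ShareEdge t u → u = s ∨ u = s') :
    weightedCount R w = w {t, s} * weightedCount (R \ {t, s}) w +
      w {t, s'} * weightedCount (R \ {t, s'}) w := by
  classical
  rw [weightedCount_peel R w ht]
  have : R.filter (ShareEdge t) = {s, s'} := by
    ext u
    simp only [Finset.mem_filter, Finset.mem_singleton, Finset.mem_insert]
    exact ⟨fun hu => h u hu.1 hu.2, by rintro (rfl | rfl) <;> simp [*]⟩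
  rw [this, Finset.sum_pair hne]

/-! ### Determinants of lists of vectors -/

/-- The determinant of the matrix whose rows are the vectors in a list; `0` if the matrix is not
square. -/
noncomputable def listDet {n : ℕ} (l : List (Fin n → ℚ)) : ℚ :=
  if l.length = n then Matrix.det (Matrix.of fun i : Fin n => l.getD i 0) else 0

theorem getD_append_cons_eq_update {n : ℕ} (A B : List (Fin n → ℚ)) (u : Fin n → ℚ)
    (hn : A.length < n) :
    (Matrix.of fun i : Fin n => (A ++ u :: B).getD i 0) =
      Matrix.updateRow (Matrix.of fun i : Fin n => (A ++ 0 :: B).getD i 0) ⟨A.length, hn⟩ u := by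
  ext i j
  rw [Matrix.updateRow_apply]
  split_ifs with h
  · subst h
    simp
  · have h' : (i : ℕ) ≠ A.length := fun e => h (Fin.ext e)
    simp only [Matrix.of_apply, List.getD_eq_getElem?_getD]
    rcases lt_or_gt_of_ne h' with h1 | h1
    · rw [List.getElem?_append_left h1, List.getElem?_append_left h1]
    · obtain ⟨k, hk⟩ := Nat.exists_eq_add_of_lt h1
      rw [List.getElem?_append_right h1.le, List.getElem?_append_right h1.le, hk]
      have : A.length + k + 1 - A.length = k + 1 := by omega
      simp [this]

theorem listDet_append_cons_add_smul {n : ℕ} (A B : List (Fin n → ℚ)) (u v : Fin n → ℚ) (c : ℚ) :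
    listDet (A ++ (u + c • v) :: B) = listDet (A ++ u :: B) + c * listDet (A ++ v :: B) := by
  unfold listDet
  simp only [List.length_append, List.length_cons]
  split_ifs with h
  · have hn : A.length < n := by omega
    rw [getD_append_cons_eq_update _ _ _ hn, getD_append_cons_eq_update _ _ u hn,
      getD_append_cons_eq_update _ _ v hn, Matrix.det_updateRow_add, Matrix.det_updateRow_smul]
  · simp

theorem listDet_append_cons_cons_self {n : ℕ} (A B : List (Fin n → ℚ)) (u : Fin n → ℚ) :
    listDet (A ++ u :: u :: B) = 0 := by
  unfold listDet
  simp only [List.length_append, List.length_cons]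
  split_ifs with h
  · refine Matrix.det_zero_of_row_eq (i := ⟨A.length, by omega⟩) (j := ⟨A.length + 1, by omega⟩)
      (by simp) ?_
    ext j
    simp [List.getD_eq_getElem?_getD]
  · rfl

theorem listDet_eq_zero {n : ℕ} (l : List (Fin n → ℚ)) (j : Fin n) (h : ∀ u ∈ l, u j = 0) :
    listDet l = 0 := by
  unfold listDet
  split_ifs with hl
  · refine Matrix.det_eq_zero_of_column_eq_zero j fun i => ?_
    have hi : (i : ℕ) < l.length := by omega
    simp only [Matrix.of_apply, List.getD_eq_getElem _ _ hi]
    exact h _ (List.getElem_mem hi)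
  · rfl

theorem listDet_ofFn {n : ℕ} (f : Fin n → Fin n → ℚ) :
    listDet (List.ofFn f) = Matrix.det (Matrix.of f) := by
  unfold listDet
  rw [if_pos (by simp)]
  congr 1
  ext i j
  simp

theorem listDet_basis {n : ℕ} :
    listDet ((List.range n).map fun i => (fun j : Fin n => if (j : ℕ) = i then (1 : ℚ) else 0))
      = 1 := by
  have : ((List.range n).map fun i => (fun j : Fin n => if (j : ℕ) = i then (1 : ℚ) else 0)) =
      List.ofFn (fun i j : Fin n => if (j : ℕ) = i then (1 : ℚ) else 0) := by
    apply List.ext_getElem <;> simp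
  rw [this, listDet_ofFn]
  convert Matrix.det_one (n := Fin n) (R := ℚ)
  ext i j
  simp [Matrix.one_apply, Fin.ext_iff, eq_comm]

/-! ### Tilings of row-convex regions as determinants of path counts -/

theorem zigzagWeight_right (r k : ℤ) : zigzagWeight {(r, k), (r, k + 1)} = 1 := by
  unfold zigzagWeight
  rw [if_neg]
  intro h
  have h1 := h (r, k) (by simp)
  have h2 := h (r, k + 1) (by simp)
  dsimp only at h1 h2
  omega

theorem zigzagWeight_up (r k : ℤ) :
    zigzagWeight {(r, k), (r + 1, k)} = if k = 0 then 1 / 2 else 1 := by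
  unfold zigzagWeight
  congr 1
  simp

/-- `PathVectors top h n L U v`: the vectors `v r k` count, for the paths of lozenges which start
at the left edge of the down-pointing triangle `(r, k)`, the weighted numbers of such paths
leaving the region `{(r, k) | top - h ≤ r < top, L r ≤ k ≤ U r}` through the right edges of its
rows. The `j`-th coordinate refers to the row `top - 1 - j`, the rows with `j < n` being those
which end with an up-pointing triangle. -/
structure PathVectors (top : ℤ) (h n : ℕ) (L U : ℤ → ℤ) (v : ℤ → ℤ → Fin n → ℚ) : Prop where
  width : ∀ r, top - h ≤ r → r < top → L r ≤ U r + 1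
  step : ∀ r k, top - h ≤ r → r < top → L r ≤ k → k ≤ U r → Even (r + k) →
    v r k = (if k + 1 ≤ U r then v r (k + 2) else 0) +
      (if r + 1 < top ∧ L (r + 1) ≤ k ∧ k ≤ U (r + 1) then (if k = 0 then 1 / 2 else 1)
        else (0 : ℚ)) • v (r + 1) (k + 1)
  last_up : ∀ r, top - h ≤ r → r < top → Odd (r + U r) →
    top - 1 - r < n ∧ v r (U r + 1) = fun j : Fin n => if (j : ℤ) = top - 1 - r then (1 : ℚ) else 0
  last_down : ∀ r, top - h ≤ r → r < top → Even (r + U r) → n ≤ top - 1 - r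
  vanish : ∀ r k, ∀ j : Fin n, top - 1 - r < (j : ℤ) → v r k j = 0
  le : n ≤ h

section Sweep

variable {top : ℤ} {h n : ℕ} {L U : ℤ → ℤ} {v : ℤ → ℤ → Fin n → ℚ}

/-- The path vectors of the paths starting at the left ends of the topmost `i` rows. -/
def startVectors (top : ℤ) (L : ℤ → ℤ) (v : ℤ → ℤ → Fin n → ℚ) (i : ℕ) : List (Fin n → ℚ) :=
  ((List.range i).filter fun m : ℕ => Even (top - 1 - m + L (top - 1 - m))).map
    fun m : ℕ => v (top - 1 - m) (L (top - 1 - m))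

/-- The unit vectors from the `i`-th on. -/
def endVectors (n i : ℕ) : List (Fin n → ℚ) :=
  (List.range' i (n - i)).map fun i => (fun j : Fin n => if (j : ℕ) = i then (1 : ℚ) else 0)

theorem endVectors_of_lt {i : ℕ} (hi : i < n) :
    endVectors n i = (fun j : Fin n => if (j : ℕ) = i then (1 : ℚ) else 0) ::
      endVectors n (i + 1) := by
  have : n - i = (n - (i + 1)) + 1 := by omega
  rw [endVectors, this, List.range'_succ]
  rfl

theorem endVectors_of_le {i : ℕ} (hi : n ≤ i) : endVectors n i = [] := by
  have : n - i = 0 := by omega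
  simp [endVectors, this]

theorem startVectors_succ (i : ℕ) :
    startVectors top L v (i + 1) = startVectors top L v i ++
      if Even (top - 1 - i + L (top - 1 - i)) then [v (top - 1 - i) (L (top - 1 - i))] else [] := by
  simp only [startVectors, List.range_succ, List.filter_append, List.map_append,
    List.filter_singleton]
  congr 1
  by_cases h : Even (top - 1 - i + L (top - 1 - i)) <;> simp [h]

theorem listDet_append_cons_zero {n : ℕ} (A B : List (Fin n → ℚ)) :
    listDet (A ++ 0 :: B) = 0 := by
  have := listDet_append_cons_add_smul A B 0 0 1
  simp only [smul_zero, add_zero, one_mul] at this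
  linarith

/-- The topmost `i` rows (those above row `r = top - 1 - i`) without the triangles in positions
`T` of the lowest of them are counted by a determinant. -/
def CountsAbove (top : ℤ) (L U : ℤ → ℤ) (v : ℤ → ℤ → Fin n → ℚ) (i : ℕ) (r : ℤ) : Prop :=
  ∀ (T : List ℤ) (R : Finset Tri), T.Pairwise (· < ·) →
    (∀ t ∈ T, r + 1 < top ∧ L (r + 1) ≤ t ∧ t ≤ U (r + 1) ∧ Even (r + t)) →
    (∀ r' j, (r', j) ∈ R ↔ (r' < top ∧ L r' ≤ j ∧ j ≤ U r') ∧
      ((r' = r + 1 ∧ j ∉ T) ∨ r + 2 ≤ r')) →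
    weightedCount R zigzagWeight =
      listDet (startVectors top L v i ++ (T.map fun t => v (r + 1) (t + 1)) ++ endVectors n i)

/-- Invariant of a sweep through row `r` from left to right, with `k` the next position. `S` lists
the triangles of the row already covered from below, `T` those of the row above already covered from
row `r`. Each recorded vertical lozenge is a path waiting at the right edge of its upper triangle,
and a path stands at the left edge of `(r, k)` exactly when that triangle points down. The unit
vectors stand for the exits of lower rows. The induction is on the number of positions left in the
row. -/
theorem PathVectors.count_row (H : PathVectors top h n L U v) {i : ℕ} (hi : i < h) {r : ℤ}
    (hr : r = top - 1 - i) (hA : CountsAbove top L U v i r) (d : ℕ) :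
    ∀ (k : ℤ) (S T : List ℤ) (R : Finset Tri), U r + 1 - k = d → L r ≤ k →
    S.Pairwise (· < ·) → (∀ s ∈ S, k ≤ s ∧ s ≤ U r ∧ Odd (r + s)) →
    T.Pairwise (· < ·) →
    (∀ t ∈ T, t < k ∧ r + 1 < top ∧ L (r + 1) ≤ t ∧ t ≤ U (r + 1) ∧ Even (r + t)) →
    (∀ r' j, (r', j) ∈ R ↔ (r' < top ∧ L r' ≤ j ∧ j ≤ U r') ∧
      ((r' = r ∧ k ≤ j ∧ j ∉ S) ∨ (r' = r + 1 ∧ j ∉ T) ∨ r + 2 ≤ r')) →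
    weightedCount R zigzagWeight =
      listDet ((startVectors top L v i ++ T.map fun t => v (r + 1) (t + 1)) ++
        ((if Even (r + k) then [v r k] else []) ++
          ((S.map fun s => v r (s + 1)) ++ endVectors n (i + 1)))) := by
  have hr1 : top - h ≤ r := by omega
  have hr2 : r < top := by omega
  induction d using Nat.strong_induction_on with
  | _ d ih =>
  intro k S T R hd hk hS hS' hT hT' hR
  rcases Nat.eq_zero_or_pos d with rfl | hd0
  · -- the row is finished
    have hkU : k = U r + 1 := by omega
    have hSn : S = [] := by
      refine List.eq_nil_iff_forall_not_mem.2 fun s hs => ?_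
      have := hS' s hs
      omega
    subst hSn
    have hA' := hA T R hT (fun t ht => (hT' t ht).2) (by
      intro r' j
      rw [hR]
      constructor
      · rintro ⟨h1, h2⟩
        refine ⟨h1, ?_⟩
        rcases h2 with ⟨rfl, h3, -⟩ | h2
        · omega
        · exact h2
      · rintro ⟨h1, h2⟩
        exact ⟨h1, Or.inr h2⟩)
    rw [hA']
    by_cases hpar : Even (r + k)
    -- The path has reached the exit of this row; its vector is the unit vector by which `endVectors
    -- n i` exceeds `endVectors n (i + 1)`.
    · obtain ⟨h1, h2⟩ := H.last_up r hr1 hr2 (by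
        rw [hkU] at hpar
        rcases Int.even_or_odd (r + U r) with h | h
        · exfalso
          rw [Int.even_iff] at h hpar
          omega
        · exact h)
      have hin : i < n := by omega
      rw [if_pos hpar, endVectors_of_lt hin, hkU, h2]
      have : (fun j : Fin n => if (j : ℤ) = top - 1 - r then (1 : ℚ) else 0) =
          fun j : Fin n => if (j : ℕ) = i then 1 else 0 := by
        ext j
        congr 1
        rw [hr, eq_iff_iff]
        omega
      simp [this]
    · have := H.last_down r hr1 hr2 (by
        rw [Int.not_even_iff_odd] at hpar
        rw [Int.odd_iff] at hpar
        rw [Int.even_iff]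
        omega)
      rw [if_neg hpar, endVectors_of_le (by omega), endVectors_of_le (by omega)]
      simp
  have hkU : k ≤ U r := by omega
  by_cases hpar : Even (r + k)
  · -- a path arrives at the left edge of the triangle `(r, k)`
    rw [if_pos hpar]
    have hpar' := Int.even_iff.1 hpar
    have hstep := H.step r k hr1 hr2 hk hkU hpar
    have hkR : (r, k) ∈ R := by
      rw [hR]
      refine ⟨⟨hr2, hk, hkU⟩, Or.inl ⟨rfl, le_rfl, fun hkS => ?_⟩⟩
      have := Int.odd_iff.1 (hS' k hkS).2.2
      omega
    have hS'' : ∀ s ∈ S, k + 1 ≤ s ∧ s ≤ U r ∧ Odd (r + s) := by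
      intro s hs
      have h1 := hS' s hs
      have := Int.odd_iff.1 h1.2.2
      exact ⟨by omega, h1.2⟩
    have hadj : ∀ u ∈ R, ShareEdge (r, k) u → u = (r, k + 1) ∨ u = (r + 1, k) := by
      rintro ⟨r', j⟩ hu hs
      rw [hR] at hu
      rcases hs with ⟨h1, h2⟩ | ⟨-, h2, h3⟩ | ⟨h1, h2, h3⟩
      · dsimp only at h1 h2
        left
        ext
        · exact h1.symm
        · dsimp only; omega
      · exact Or.inr (Prod.ext h2 h3)
      · dsimp only at h1 h2 h3
        rw [Int.even_iff] at h1
        omega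
    -- the step to the row above
    have hNE : r + 1 < top ∧ L (r + 1) ≤ k ∧ k ≤ U (r + 1) →
        (r + 1, k) ∈ R ∧ weightedCount (R \ {(r, k), (r + 1, k)}) zigzagWeight =
          listDet ((startVectors top L v i ++ T.map fun t => v (r + 1) (t + 1)) ++
            v (r + 1) (k + 1) ::
              ((S.map fun s => v r (s + 1)) ++ endVectors n (i + 1))) := by
      intro hc
      refine ⟨?_, ?_⟩
      · rw [hR]
        refine ⟨hc, Or.inr (Or.inl ⟨rfl, fun hkT => ?_⟩)⟩
        have := (hT' k hkT).1
        omega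
      -- After the vertical lozenge the path waits at the right edge of `(r + 1, k)`, so `k` joins
      -- `T`.
      · have := ih (d - 1) (by omega) (k + 1) S (T ++ [k]) (R \ {(r, k), (r + 1, k)}) (by omega)
          (by omega) hS hS''
          (by
            rw [List.pairwise_append]
            refine ⟨hT, List.pairwise_singleton _ _, ?_⟩
            intro a ha b hb
            rw [List.mem_singleton] at hb
            rw [hb]
            exact (hT' a ha).1)
          (by
            intro t ht
            rw [List.mem_append, List.mem_singleton] at ht
            rcases ht with ht | rfl
            · have := hT' t ht
              exact ⟨by omega, this.2⟩
            · exact ⟨by omega, hc.1, hc.2.1, hc.2.2, hpar⟩)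
          (by
            intro r' j
            simp only [Finset.mem_sdiff, hR, Finset.mem_insert, Finset.mem_singleton,
              Prod.mk.injEq, List.mem_append]
            grind)
        rw [this, if_neg (by rw [Int.even_iff]; omega)]
        simp
    set c : ℚ := if r + 1 < top ∧ L (r + 1) ≤ k ∧ k ≤ U (r + 1) then
      (if k = 0 then 1 / 2 else 1) else 0 with hc
    by_cases hup : k + 1 ≤ U r ∧ k + 1 ∉ S
    · have hupR : (r, k + 1) ∈ R := by
        rw [hR]
        exact ⟨⟨hr2, by omega, hup.1⟩, Or.inl ⟨rfl, by omega, hup.2⟩⟩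
      have hse : ShareEdge (r, k) (r, k + 1) := Or.inl ⟨rfl, Or.inl rfl⟩
      have hE : weightedCount (R \ {(r, k), (r, k + 1)}) zigzagWeight =
          listDet ((startVectors top L v i ++ T.map fun t => v (r + 1) (t + 1)) ++
            v r (k + 2) :: ((S.map fun s => v r (s + 1)) ++ endVectors n (i + 1))) := by
        have hS2 : ∀ s ∈ S, k + 2 ≤ s ∧ s ≤ U r ∧ Odd (r + s) := by
          intro s hs
          have h1 := hS'' s hs
          have : s ≠ k + 1 := by rintro rfl; exact hup.2 hs
          exact ⟨by omega, h1.2⟩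
        have := ih (d - 2) (by omega) (k + 2) S T (R \ {(r, k), (r, k + 1)}) (by omega)
          (by omega) hS hS2 hT
          (fun t ht => by
            have := hT' t ht
            exact ⟨by omega, this.2⟩)
          (by
            intro r' j
            simp only [Finset.mem_sdiff, hR, Finset.mem_insert, Finset.mem_singleton,
              Prod.mk.injEq]
            have : ∀ s ∈ S, k + 2 ≤ s := fun s hs => (hS2 s hs).1
            grind)
        rw [this, if_pos (by rw [Int.even_iff]; omega)]
        simp
      rw [hstep, if_pos hup.1]
      simp only [List.cons_append, List.nil_append]
      -- The two terms of the path recurrence are the two lozenges that can cover `(r, k)`.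
      rw [listDet_append_cons_add_smul, ← hE]
      by_cases hcond : r + 1 < top ∧ L (r + 1) ≤ k ∧ k ≤ U (r + 1)
      · obtain ⟨h1, h2⟩ := hNE hcond
        rw [← h2, weightedCount_two R zigzagWeight hkR hupR h1 (by simp) hse
          (Or.inr (Or.inl ⟨hpar, rfl, rfl⟩)) hadj, zigzagWeight_right, zigzagWeight_up, one_mul,
          hc, if_pos hcond]
      · rw [hc, if_neg hcond, zero_mul, add_zero,
          weightedCount_forced R zigzagWeight hkR hupR hse, zigzagWeight_right, one_mul]
        intro u hu hs
        rcases hadj u hu hs with rfl | rfl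
        · rfl
        · rw [hR] at hu
          exact absurd hu.1 hcond
    -- With no right neighbour available, only the vertical lozenge remains. The extra term of the
    -- determinant must vanish: its vector is `0` at the end of the row, and otherwise equals the
    -- vector of the path waiting at `k + 1 ∈ S`.
    · have hvert : weightedCount R zigzagWeight = c *
          listDet ((startVectors top L v i ++ T.map fun t => v (r + 1) (t + 1)) ++
            v (r + 1) (k + 1) ::
              ((S.map fun s => v r (s + 1)) ++ endVectors n (i + 1))) := by
        have hupR : (r, k + 1) ∉ R := by
          rw [hR]
          rintro ⟨h1, h2⟩
          apply hup
          refine ⟨h1.2.2, ?_⟩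
          rcases h2 with h2 | h2 | h2
          · exact h2.2.2
          · omega
          · omega
        by_cases hcond : r + 1 < top ∧ L (r + 1) ≤ k ∧ k ≤ U (r + 1)
        · obtain ⟨h1, h2⟩ := hNE hcond
          rw [← h2, weightedCount_forced R zigzagWeight hkR h1
            (Or.inr (Or.inl ⟨hpar, rfl, rfl⟩)), zigzagWeight_up, hc, if_pos hcond]
          intro u hu hs
          rcases hadj u hu hs with rfl | rfl
          · exact absurd hu hupR
          · rfl
        · rw [hc, if_neg hcond, zero_mul]
          refine weightedCount_eq_zero R _ hkR fun u hu hs => ?_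
          rcases hadj u hu hs with rfl | rfl
          · exact hupR hu
          · rw [hR] at hu
            exact hcond hu.1
      rw [hvert, hstep]
      simp only [List.cons_append, List.nil_append]
      rw [listDet_append_cons_add_smul]
      by_cases hU : k + 1 ≤ U r
      · have hkS : k + 1 ∈ S := by
          by_contra hkS
          exact hup ⟨hU, hkS⟩
        obtain ⟨S', rfl⟩ : ∃ S', S = (k + 1) :: S' := by
          cases S with
          | nil => simp at hkS
          | cons s S' =>
            refine ⟨S', ?_⟩
            rcases List.mem_cons.1 hkS with e | h1
            · rw [e]
            · have h2 := (List.pairwise_cons.1 hS).1 _ h1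
              have h3 := (hS'' s (by simp)).1
              omega
        rw [if_pos hU]
        have e : k + 1 + 1 = k + 2 := by ring
        simp only [List.map_cons, List.cons_append, e]
        rw [listDet_append_cons_cons_self, zero_add]
      · rw [if_neg hU, listDet_append_cons_zero, zero_add]
  · -- no path arrives at the left of the triangle `(r, k)`
    rw [if_neg hpar]
    rw [Int.not_even_iff_odd] at hpar
    have hpar' := Int.odd_iff.1 hpar
    -- If the up-pointing triangle `(r, k)` is covered from below, the path waiting at its right
    -- edge becomes the current one. Otherwise it pairs with `(r, k + 1)` in a lozenge lying on no
    -- path, and the list of vectors does not change.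
    by_cases hkS : k ∈ S
    · obtain ⟨S', rfl⟩ : ∃ S', S = k :: S' := by
        cases S with
        | nil => simp at hkS
        | cons s S' =>
          refine ⟨S', ?_⟩
          rcases List.mem_cons.1 hkS with e | h1
          · rw [e]
          · have h2 := (List.pairwise_cons.1 hS).1 _ h1
            have h3 := (hS' s (by simp)).1
            omega
      have hlt : ∀ s ∈ S', k < s := (List.pairwise_cons.1 hS).1
      have := ih (d - 1) (by omega) (k + 1) S' T R (by omega) (by omega)
        (List.pairwise_cons.1 hS).2
        (fun s hs => by
          have h1 := hS' s (List.mem_cons_of_mem _ hs)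
          have h2 := hlt s hs
          exact ⟨by omega, h1.2⟩) hT
        (fun t ht => by
          have := hT' t ht
          exact ⟨by omega, this.2⟩)
        (by
          intro r' j
          simp only [hR, List.mem_cons]
          grind)
      rw [this, if_pos (by rw [Int.even_iff]; omega)]
      simp
    · have hkR : (r, k) ∈ R := by
        rw [hR]
        exact ⟨⟨hr2, hk, hkU⟩, Or.inl ⟨rfl, le_rfl, hkS⟩⟩
      have hadj : ∀ u ∈ R, ShareEdge (r, k) u → u = (r, k + 1) := by
        rintro ⟨r', j⟩ hu hs
        rw [hR] at hu
        rcases hs with ⟨h1, h2⟩ | ⟨h1, h2, h3⟩ | ⟨h1, h2, h3⟩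
        · dsimp only at h1 h2
          ext
          · exact h1.symm
          · dsimp only; omega
        · dsimp only at h1
          rw [Int.even_iff] at h1
          omega
        · dsimp only at h1 h2 h3
          omega
      have hS2 : ∀ s ∈ S, k + 2 ≤ s ∧ s ≤ U r ∧ Odd (r + s) := by
        intro s hs
        have h1 := hS' s hs
        have h2 := Int.odd_iff.1 h1.2.2
        have : s ≠ k := by rintro rfl; exact hkS hs
        exact ⟨by omega, h1.2⟩
      by_cases hU : k = U r
      · have hSn : S = [] := by
          refine List.eq_nil_iff_forall_not_mem.2 fun s hs => ?_
          have := hS2 s hs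
          omega
        -- The last triangle of the row cannot be covered. On the other side, no vector in the list
        -- has a nonzero `i`-th coordinate: higher paths never descend to this exit, and the unit
        -- vectors left start at `i + 1`.
        rw [weightedCount_eq_zero R _ hkR]
        · obtain ⟨h1, -⟩ := H.last_up r hr1 hr2 (hU ▸ hpar)
          symm
          refine listDet_eq_zero _ ⟨i, by omega⟩ ?_
          intro u hu
          subst hSn
          simp only [List.mem_append, List.map_nil, List.nil_append, List.mem_map,
            startVectors, List.mem_filter, List.mem_range, endVectors, List.mem_range'_1] at hu
          rcases hu with (⟨m, hm, rfl⟩ | ⟨t, -, rfl⟩) | ⟨m, hm, rfl⟩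
          · exact H.vanish _ _ _ (by dsimp only; omega)
          · exact H.vanish _ _ _ (by dsimp only; omega)
          · dsimp only
            rw [if_neg (by omega)]
        · intro u hu hs
          have := hadj u hu hs
          subst this
          rw [hR] at hu
          omega
      · have hsR : (r, k + 1) ∈ R := by
          rw [hR]
          refine ⟨⟨hr2, by omega, by omega⟩, Or.inl ⟨rfl, by omega, fun h1 => ?_⟩⟩
          have := hS2 _ h1
          omega
        rw [weightedCount_forced R zigzagWeight hkR hsR (Or.inl ⟨rfl, Or.inl rfl⟩) hadj,
          zigzagWeight_right, one_mul]
        have := ih (d - 2) (by omega) (k + 2) S T (R \ {(r, k), (r, k + 1)}) (by omega)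
          (by omega) hS hS2 hT
          (fun t ht => by
            have := hT' t ht
            exact ⟨by omega, this.2⟩)
          (by
            intro r' j
            simp only [Finset.mem_sdiff, hR, Finset.mem_insert, Finset.mem_singleton,
              Prod.mk.injEq]
            have : ∀ s ∈ S, k + 2 ≤ s := fun s hs => (hS2 s hs).1
            grind)
        rw [this, if_neg (by rw [Int.even_iff]; omega)]

theorem PathVectors.countsAbove (H : PathVectors top h n L U v) (i : ℕ) (hi : i ≤ h) :
    CountsAbove top L U v i (top - 1 - i) := by
  induction i with
  | zero =>
    intro T R hT hT' hR
    have hTn : T = [] := by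
      refine List.eq_nil_iff_forall_not_mem.2 fun t ht => ?_
      have := (hT' t ht).1
      simp at this
    have hRn : R = ∅ := by
      refine Finset.eq_empty_of_forall_notMem ?_
      rintro ⟨r', j⟩ hp
      rw [hR] at hp
      push_cast at hp
      omega
    subst hTn hRn
    rw [weightedCount_empty]
    have := listDet_basis (n := n)
    simp only [startVectors, endVectors, List.range_zero, List.filter_nil, List.map_nil,
      List.nil_append, Nat.sub_zero]
    rw [← List.range_eq_range', this]
  | succ i ih =>
    have hA := ih (by omega)
    intro T R hT hT' hR
    have er : top - 1 - ((i + 1 : ℕ) : ℤ) + 1 = top - 1 - i := by push_cast; ring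
    set r : ℤ := top - 1 - i with hr
    have er2 : top - 1 - ((i + 1 : ℕ) : ℤ) + 2 = r + 1 := by push_cast; omega
    rw [er] at hT' ⊢
    have hw := H.width r (by omega) (by omega)
    -- The triangles missing from row `r` were covered from the row below, so they take the role of
    -- `S`; nothing is missing from the row above yet.
    have := H.count_row (by omega) hr hA (U r + 1 - L r).toNat (L r) T [] R (by omega) le_rfl hT
      (fun s hs => by
        have h1 := hT' s hs
        have h2 := Int.even_iff.1 h1.2.2.2
        refine ⟨h1.2.1, h1.2.2.1, ?_⟩
        rw [Int.odd_iff]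
        push_cast at h2
        omega)
      List.Pairwise.nil (by simp)
      (by
        intro r' j
        rw [hR, er, er2]
        simp only [List.not_mem_nil, not_false_eq_true, and_true]
        constructor
        · rintro ⟨h1, ⟨rfl, h2⟩ | h2⟩
          · exact ⟨h1, Or.inl ⟨rfl, h1.2.1, h2⟩⟩
          · exact ⟨h1, Or.inr (by omega)⟩
        · rintro ⟨h1, ⟨rfl, -, h2⟩ | h2⟩
          · exact ⟨h1, Or.inl ⟨rfl, h2⟩⟩
          · exact ⟨h1, Or.inr (by omega)⟩)
    rw [this, startVectors_succ]
    simp only [List.map_nil, List.append_nil, List.append_assoc, ← hr]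

/-- The weighted count of the tilings of a row-convex region is the determinant of the path
vectors of its starting points. -/
theorem PathVectors.weightedCount_eq (H : PathVectors top h n L U v) (R : Finset Tri)
    (hR : ∀ r j, (r, j) ∈ R ↔ (top - h ≤ r ∧ r < top) ∧ L r ≤ j ∧ j ≤ U r) :
    weightedCount R zigzagWeight = listDet (startVectors top L v h) := by
  rw [H.countsAbove h le_rfl [] R List.Pairwise.nil (by simp)
    (by
      intro r j
      rw [hR]
      simp only [List.not_mem_nil, not_false_eq_true, and_true]
      omega), endVectors_of_le H.le]
  simp

end Sweep

/-! ### Binomial path counts for the two regions -/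

/-- The binomial coefficient with an integer as lower entry. -/
def binom (N : ℕ) (m : ℤ) : ℚ := if m < 0 then 0 else (N.choose m.toNat : ℚ)

theorem binom_of_neg {N : ℕ} {m : ℤ} (h : m < 0) : binom N m = 0 := if_pos h

theorem binom_natCast (N m : ℕ) : binom N m = N.choose m := by
  simp [binom]

theorem binom_of_lt {N : ℕ} {m : ℤ} (h : (N : ℤ) < m) : binom N m = 0 := by
  obtain ⟨k, rfl⟩ := Int.eq_ofNat_of_zero_le (show 0 ≤ m by omega)
  rw [binom_natCast, Nat.choose_eq_zero_of_lt (by omega), Nat.cast_zero]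

theorem binom_zero (m : ℤ) : binom 0 m = if m = 0 then 1 else 0 := by
  split_ifs with h
  · simp [h, binom]
  · rcases lt_or_gt_of_ne h with h | h
    · exact binom_of_neg h
    · exact binom_of_lt h

theorem binom_succ (N : ℕ) (m : ℤ) : binom (N + 1) m = binom N m + binom N (m - 1) := by
  rcases lt_trichotomy m 0 with h | rfl | h
  · rw [binom_of_neg h, binom_of_neg h, binom_of_neg (by omega), add_zero]
  · rw [binom_of_neg (show (0 : ℤ) - 1 < 0 by omega)]
    simp [binom]
  · obtain ⟨k, hk⟩ := Int.eq_ofNat_of_zero_le (show 0 ≤ m - 1 by omega)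
    have e : m = ((k + 1 : ℕ) : ℤ) := by push_cast; omega
    have e' : ((k + 1 : ℕ) : ℤ) - 1 = (k : ℕ) := by push_cast; ring
    rw [e, e', binom_natCast, binom_natCast, binom_natCast, Nat.choose_succ_succ]
    push_cast
    ring

/-- The number of lattice paths as in `binom (N + 1) m`, a first step upwards having weight
`1 / 2`. -/
def halfBinom (N : ℕ) (m : ℤ) : ℚ := binom N m + 1 / 2 * binom N (m - 1)

theorem halfBinom_succ (N : ℕ) (m : ℤ) :
    halfBinom (N + 1) m = halfBinom N m + halfBinom N (m - 1) := by
  simp only [halfBinom, binom_succ]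
  ring

/-- The path vectors of the regions considered here. -/
def stepVector (top y : ℤ) (n : ℕ) (r k : ℤ) (j : Fin n) : ℚ :=
  if k = 0 then halfBinom (y - (k + r) / 2 - 1).toNat (top - 1 - r - j)
  else binom (y - (k + r) / 2).toNat (top - 1 - r - j)

/-- Each step, to the right or upwards, raises `(k + r) / 2` by one, and all exits lie where this
equals `y`. Hence the number of steps left is fixed, the number of upward ones is prescribed by the
exit, and the recurrence is Pascal's rule. Only a first step at `k = 0` can carry the weight `1/2`,
which gives `halfBinom`. -/
theorem pathVectors_stepVector {y ρ : ℤ} {h n : ℕ} {L U : ℤ → ℤ} (hn : n ≤ h)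
    (hU : ∀ r, U r = if r < ρ then 2 * y - 2 * ρ + r else 2 * y - 1 - r)
    (hy : ρ + n ≤ 2 * y)
    (hL : ∀ r, ρ + n - h ≤ r → r < ρ + n → 0 ≤ L r ∧ L r ≤ U r + 1)
    (hL' : ∀ r k, ρ + n - h ≤ r → r + 1 < ρ + n → L r ≤ k → Even (r + k) → L (r + 1) ≤ k) :
    PathVectors (ρ + n) h n L U (stepVector (ρ + n) y n) := by
  refine ⟨fun r h1 h2 => (hL r h1 h2).2, ?_, ?_, ?_, ?_, hn⟩
  · intro r k h1 h2 h3 h4 h5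
    obtain ⟨q, hq⟩ := h5
    have hk0 := (hL r h1 h2).1
    have hk : k = q + q - r := by omega
    have hqy : q < y := by
      have := hU r
      split_ifs at this <;> omega
    have e1 : (k + r) / 2 = q := by omega
    have e2 : (k + 2 + r) / 2 = q + 1 := by omega
    have e3 : (k + 1 + (r + 1)) / 2 = q + 1 := by omega
    obtain ⟨N, hN⟩ := Int.eq_ofNat_of_zero_le (show 0 ≤ y - q - 1 by omega)
    have f1 : (y - q).toNat = N + 1 := by omega
    have f2 : (y - (q + 1)).toNat = N := by omega
    have f3 : (y - q - 1).toNat = N := by omega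
    ext j
    have hj : (j : ℤ) < n := by exact_mod_cast j.2
    have g1 : (if k + 1 ≤ U r then stepVector (ρ + n) y n r (k + 2) else 0) j =
        binom N (ρ + n - 1 - r - j) := by
      split_ifs with hc
      · rw [stepVector, if_neg (by omega), e2, f2]
      -- The southeastern side needs no separate condition: a path crossing it has too few steps
      -- left to climb to an exit.
      · rw [binom_of_lt]
        · rfl
        · have := hU r
          split_ifs at this <;> omega
    have g2 : ((if r + 1 < ρ + n ∧ L (r + 1) ≤ k ∧ k ≤ U (r + 1) then
        (if k = 0 then 1 / 2 else 1) else (0 : ℚ)) •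
          stepVector (ρ + n) y n (r + 1) (k + 1)) j =
        (if k = 0 then 1 / 2 else 1) * binom N (ρ + n - 1 - r - j - 1) := by
      have e4 : ρ + n - 1 - (r + 1) - j = ρ + n - 1 - r - j - 1 := by ring
      have e5 : stepVector (ρ + n) y n (r + 1) (k + 1) j =
          binom N (ρ + n - 1 - r - j - 1) := by
        rw [stepVector, if_neg (by omega), e3, f2, e4]
      rw [Pi.smul_apply, smul_eq_mul, e5]
      by_cases hr : r + 1 < ρ + n
      · rw [if_pos]
        refine ⟨hr, hL' r k h1 hr h3 ⟨q, hq⟩, ?_⟩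
        have := hU r
        have := hU (r + 1)
        split_ifs at * <;> omega
      · rw [if_neg (fun hc => hr hc.1), binom_of_neg (by omega)]
        simp
    rw [Pi.add_apply, g1, g2, stepVector, e1, f1, f3]
    split_ifs with hc
    · rfl
    · rw [binom_succ, one_mul]
  · intro r h1 h2 h3
    have h4 := Int.odd_iff.1 h3
    have h5 := hU r
    split_ifs at h5 with h6
    · omega
    · refine ⟨by omega, ?_⟩
      ext j
      have : (y - (U r + 1 + r) / 2).toNat = 0 := by omega
      rw [stepVector, if_neg (by omega), this, binom_zero]
      congr 1
      rw [eq_iff_iff]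
      omega
  · intro r h1 h2 h3
    have h4 := Int.even_iff.1 h3
    have h5 := hU r
    split_ifs at h5 with h6 <;> omega
  · intro r k j hj
    rw [stepVector, halfBinom, binom_of_neg (by omega), binom_of_neg (by omega),
      binom_of_neg (by omega)]
    simp

/-- The matrix of weighted numbers of paths of lozenges in the region `B'`. -/
def tilingMatrix (x a b c : ℕ) : Matrix (Fin (c + b)) (Fin (c + b)) ℚ :=
  Matrix.of fun i j : Fin (c + b) =>
    if (i : ℕ) < c then halfBinom (x + a + i) (2 * i + 1 - j)
    else binom (x + 2 * a + c) (2 * a + c + i - j)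

theorem startVectors_even {n : ℕ} {top : ℤ} {L : ℤ → ℤ} (v : ℤ → ℤ → Fin n → ℚ) (c : ℕ)
    (htop : Even top) (hL : ∀ m : ℕ, m < 2 * c → L (top - 1 - m) = 0) :
    startVectors top L v (2 * c) =
      (List.range c).map fun i : ℕ => v (top - 2 - 2 * i) 0 := by
  induction c with
  | zero => simp [startVectors]
  | succ c ih =>
    have ht := Int.even_iff.1 htop
    have e : 2 * (c + 1) = 2 * c + 1 + 1 := by ring
    rw [e, startVectors_succ, startVectors_succ, ih (fun m hm => hL m (by omega)),
      hL (2 * c) (by omega), hL (2 * c + 1) (by omega),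
      if_neg (by rw [Int.even_iff]; push_cast; omega),
      if_pos (by rw [Int.even_iff]; push_cast; omega), List.append_nil, List.range_succ,
      List.map_append, List.map_singleton]
    have e' : top - 1 - ((2 * c + 1 : ℕ) : ℤ) = top - 2 - 2 * (c : ℕ) := by push_cast; ring
    rw [e']

theorem startVectors_add_of_odd {n : ℕ} {top : ℤ} {L : ℤ → ℤ} (v : ℤ → ℤ → Fin n → ℚ)
    (i d : ℕ)
    (hL : ∀ m : ℕ, i ≤ m → m < i + d → Odd (top - 1 - m + L (top - 1 - m))) :
    startVectors top L v (i + d) = startVectors top L v i := by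
  induction d with
  | zero => rfl
  | succ d ih =>
    rw [← add_assoc, startVectors_succ, ih (fun m h1 h2 => hL m h1 (by omega)), if_neg,
      List.append_nil]
    rw [Int.not_even_iff_odd]
    exact hL _ (by omega) (by omega)

theorem startVectors_add_of_even {n : ℕ} {top : ℤ} {L : ℤ → ℤ} (v : ℤ → ℤ → Fin n → ℚ)
    (i d : ℕ)
    (hL : ∀ m : ℕ, i ≤ m → m < i + d → Even (top - 1 - m + L (top - 1 - m))) :
    startVectors top L v (i + d) = startVectors top L v i ++
      (List.range d).map fun u : ℕ => v (top - 1 - i - u) (L (top - 1 - i - u)) := by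
  induction d with
  | zero => simp
  | succ d ih =>
    rw [← add_assoc, startVectors_succ, ih (fun m h1 h2 => hL m h1 (by omega)), if_pos,
      List.range_succ, List.map_append, List.append_assoc]
    · have : top - 1 - ((i + d : ℕ) : ℤ) = top - 1 - i - d := by push_cast; ring
      rw [this]
      rfl
    · exact hL _ (by omega) (by omega)

theorem map_range_append_map_range {α : Type*} (f g : ℕ → α) (c b : ℕ) :
    (List.range c).map f ++ (List.range b).map g =
      List.ofFn fun i : Fin (c + b) => if (i : ℕ) < c then f i else g (i - c) := by
  apply List.ext_getElem
  · simp
  · intro i h1 h2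
    simp only [List.getElem_append, List.length_map, List.length_range, List.getElem_map,
      List.getElem_range, List.getElem_ofFn]
    split_ifs <;> rfl

theorem weightedCount_regionB' (x a b c : ℕ) :
    weightedCount (regionB' x a b c) zigzagWeight = (tilingMatrix x a b c).det := by
  set ρ : ℤ := 2 * a + c - b with hρ
  set y : ℤ := x + 2 * a + c with hy
  set L : ℤ → ℤ := fun r => if r < 0 then -r else if r < 2 * a then r + 1 else 0 with hL
  set U : ℤ → ℤ := fun r => if r < ρ then 2 * y - 2 * ρ + r else 2 * y - 1 - r with hU
  have htop : ρ + ((c + b : ℕ) : ℤ) = 2 * a + 2 * c := by push_cast; ring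
  have H := pathVectors_stepVector (y := y) (ρ := ρ) (h := 2 * c + 2 * a + b) (n := c + b)
    (L := L) (U := U) (by omega) (fun r => rfl) (by push_cast; omega)
    (by
      intro r h1 h2
      simp only [hL, hU]
      push_cast at h1 h2
      split_ifs <;> omega)
    (by
      intro r k h1 h2 h3 h4
      have h5 := Int.even_iff.1 h4
      simp only [hL] at h3 ⊢
      push_cast at h1 h2
      split_ifs at * <;> omega)
  rw [htop] at H
  have hR : ∀ r j, (r, j) ∈ regionB' x a b c ↔
      ((2 * a + 2 * c : ℤ) - ((2 * c + 2 * a + b : ℕ) : ℤ) ≤ r ∧ r < 2 * a + 2 * c) ∧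
        L r ≤ j ∧ j ≤ U r := by
    intro r j
    simp only [regionB', halvedHexagon, downTriangle, Finset.mem_sdiff, Finset.mem_filter,
      Finset.mem_product, Finset.mem_Ico, Finset.mem_Icc, hL, hU, abs_le]
    push_cast
    split_ifs <;> omega
  -- From the top: every second one of the `2 * c` zigzag rows starts a path, the `2 * a` rows along
  -- the removed triangle start none, and each of the `b` rows of the southwestern side starts one.
  rw [H.weightedCount_eq _ hR, startVectors_add_of_even, startVectors_add_of_odd,
    startVectors_even, map_range_append_map_range, listDet_ofFn]
  · congr 1
    ext i j
    simp only [tilingMatrix, Matrix.of_apply]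
    split_ifs with hi
    · rw [stepVector, if_pos rfl]
      congr 1 <;> omega
    · have hLi : L (2 * a + 2 * c - 1 - ((2 * c + 2 * a : ℕ) : ℤ) - ((i - c : ℕ) : ℤ)) =
          1 + (i - c : ℕ) := by
        simp only [hL]
        push_cast
        split_ifs <;> omega
      rw [hLi, stepVector, if_neg (by omega)]
      congr 1 <;> omega
  · exact ⟨(a + c : ℤ), by ring⟩
  · intro m hm
    simp only [hL]
    split_ifs <;> omega
  · intro m h1 h2
    rw [Int.odd_iff]
    simp only [hL]
    split_ifs <;> omega
  · intro m h1 h2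
    rw [Int.even_iff]
    simp only [hL]
    split_ifs <;> omega

theorem weightedCount_regionP' (a c : ℕ) :
    weightedCount (regionP' c c a) zigzagWeight = (tilingMatrix 0 a 0 c).det := by
  obtain ⟨ρ, hρ⟩ : ∃ ρ : ℤ, ρ = c := ⟨_, rfl⟩
  set y : ℤ := a + c with hy
  set L : ℤ → ℤ := fun _ => 0 with hL
  set U : ℤ → ℤ := fun r => if r < ρ then 2 * y - 2 * ρ + r else 2 * y - 1 - r with hU
  have htop : ρ + ((c + 0 : ℕ) : ℤ) = 2 * c := by push_cast; omega
  have H := pathVectors_stepVector (y := y) (ρ := ρ) (h := 2 * c) (n := c + 0)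
    (L := L) (U := U) (by omega) (fun r => rfl) (by push_cast; omega)
    (by
      intro r h1 h2
      simp only [hL, hU]
      push_cast at h1 h2
      split_ifs <;> omega)
    (by
      intro r k h1 h2 h3 h4
      exact h3)
  rw [htop] at H
  have hR : ∀ r j, (r, j) ∈ regionP' c c a ↔
      ((2 * c : ℤ) - ((2 * c : ℕ) : ℤ) ≤ r ∧ r < 2 * c) ∧ L r ≤ j ∧ j ≤ U r := by
    intro r j
    simp only [regionP', hexagon, Finset.mem_filter,
      Finset.mem_product, Finset.mem_Ico, Finset.mem_Icc, hL, hU]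
    push_cast
    split_ifs <;> omega
  have hs := map_range_append_map_range
    (fun i : ℕ => stepVector (2 * c) y (c + 0) (2 * c - 2 * 1 - 2 * i) 0) (fun _ => 0) c 0
  rw [List.range_zero, List.map_nil, List.append_nil] at hs
  rw [H.weightedCount_eq _ hR, startVectors_even]
  · simp only [mul_one] at hs
    rw [hs, listDet_ofFn]
    congr 1
    ext i j
    simp only [tilingMatrix, Matrix.of_apply]
    have hi : (i : ℕ) < c := i.2
    rw [if_pos hi, if_pos hi, stepVector, if_pos rfl]
    congr 1 <;> omega
  · exact ⟨(c : ℤ), by ring⟩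
  · intro m hm
    rfl

/-! ### Pascal column operations and the determinant at `x = 0` -/

/-- Multiplication by the matrix of binomial coefficients shifts the upper parameter of a family
satisfying the recurrence of Pascal's triangle. -/
theorem sum_choose_mul_of_pascal (F : ℕ → ℤ → ℚ)
    (hF : ∀ N m, F (N + 1) m = F N m + F N (m - 1)) (l : ℕ) (n N : ℕ) (m : ℤ) (hl : l < n) :
    ∑ j ∈ Finset.range n, F N (m - j) * (l.choose j : ℚ) = F (N + l) m := by
  have hstep : ∀ N l n m, ∑ j ∈ Finset.range (n + 1), F N (m - j) * ((l + 1).choose j : ℚ) =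
      ∑ j ∈ Finset.range (n + 1), F N (m - j) * (l.choose j : ℚ) +
        ∑ j ∈ Finset.range n, F N (m - 1 - j) * (l.choose j : ℚ) := by
    intro N l n m
    rw [Finset.sum_range_succ', Finset.sum_range_succ' _ n]
    have : ∀ j : ℕ, F N (m - ((j + 1 : ℕ) : ℤ)) * ((l + 1).choose (j + 1) : ℚ) =
        F N (m - ((j + 1 : ℕ) : ℤ)) * (l.choose (j + 1) : ℚ) +
          F N (m - 1 - j) * (l.choose j : ℚ) := by
      intro j
      have e : m - 1 - (j : ℤ) = m - ((j + 1 : ℕ) : ℤ) := by push_cast; ring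
      rw [e, Nat.choose_succ_succ]
      push_cast
      ring
    simp only [this, Finset.sum_add_distrib, Nat.choose_zero_right]
    ring
  induction l generalizing n m N with
  | zero =>
    rw [Finset.sum_eq_single 0]
    · simp
    · intro j _ hj
      rw [Nat.choose_eq_zero_of_lt (by omega)]
      simp
    · intro h
      simp at h
      omega
  | succ l ih =>
    obtain ⟨n, rfl⟩ : ∃ n', n = n' + 1 := ⟨n - 1, by omega⟩
    rw [hstep, ih _ _ _ (by omega), ih _ _ _ (by omega), ← add_assoc, hF]

/-- Right multiplication by the unitriangular Pascal matrix moves the column index from the lower to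
the upper parameter, so every row becomes a polynomial in the column index. -/
theorem det_tilingMatrix_eq (x a b c : ℕ) :
    (tilingMatrix x a b c).det = Matrix.det (Matrix.of fun i l : Fin (c + b) =>
      if (i : ℕ) < c then halfBinom (x + a + i + l) (2 * i + 1)
      else binom (x + 2 * a + c + l) (2 * a + c + i)) := by
  have hP : Matrix.det (Matrix.of fun j l : Fin (c + b) => ((l : ℕ).choose j : ℚ)) = 1 := by
    rw [Matrix.det_of_isUpperTriangular]
    · simp
    · intro i j hij
      have : (j : ℕ) < i := hij
      simp [Nat.choose_eq_zero_of_lt this]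
  rw [← mul_one (tilingMatrix x a b c).det, ← hP, ← Matrix.det_mul]
  congr 1
  ext i l
  rw [Matrix.mul_apply]
  simp only [tilingMatrix, Matrix.of_apply]
  split_ifs with hi
  · rw [← sum_choose_mul_of_pascal halfBinom halfBinom_succ l (c + b) _ _ l.2, Finset.sum_range]
  · rw [← sum_choose_mul_of_pascal binom binom_succ l (c + b) _ _ l.2, Finset.sum_range]

/-- For `x = 0` the southern side is empty and the paths from the southwestern side are forced: the
lower left block vanishes and the lower right one is unitriangular. -/
theorem det_tilingMatrix_zero (a b c : ℕ) :
    (tilingMatrix 0 a b c).det = (tilingMatrix 0 a 0 c).det := by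
  rw [← Matrix.det_submatrix_equiv_self finSumFinEquiv]
  have h21 : ((tilingMatrix 0 a b c).submatrix finSumFinEquiv finSumFinEquiv).toBlocks₂₁ = 0 := by
    ext i j
    simp only [Matrix.toBlocks₂₁, tilingMatrix, Matrix.submatrix_apply, Matrix.of_apply,
      finSumFinEquiv_apply_left, finSumFinEquiv_apply_right, Fin.val_natAdd, Fin.val_castAdd,
      Matrix.zero_apply]
    rw [if_neg (by omega), binom_of_lt (by push_cast; omega)]
  have h22 : Matrix.det ((tilingMatrix 0 a b c).submatrix finSumFinEquiv
      finSumFinEquiv).toBlocks₂₂ = 1 := by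
    rw [Matrix.det_of_isUpperTriangular]
    · refine Finset.prod_eq_one fun i _ => ?_
      simp only [Matrix.toBlocks₂₂, tilingMatrix, Matrix.submatrix_apply, Matrix.of_apply,
        finSumFinEquiv_apply_right, Fin.val_natAdd]
      rw [if_neg (by omega)]
      have : (2 * a + c + ((c + i : ℕ) : ℤ) - ((c + i : ℕ) : ℤ)) = ((0 + 2 * a + c : ℕ) : ℤ) := by
        push_cast; ring
      rw [this, binom_natCast, Nat.choose_self, Nat.cast_one]
    · intro i j hij
      have : (j : ℕ) < i := hij
      simp only [Matrix.toBlocks₂₂, tilingMatrix, Matrix.submatrix_apply, Matrix.of_apply,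
        finSumFinEquiv_apply_right, Fin.val_natAdd]
      rw [if_neg (by omega), binom_of_lt (by push_cast; omega)]
  rw [← Matrix.fromBlocks_toBlocks ((tilingMatrix 0 a b c).submatrix _ _), h21,
    Matrix.det_fromBlocks_zero₂₁, h22, mul_one]
  congr 1

/-! ### Matrix entries as polynomials -/

/-- The rising factorial. -/
def rising (z : ℚ) (n : ℕ) : ℚ := ∏ k ∈ Finset.range n, (z + k)

@[simp]
theorem rising_zero (z : ℚ) : rising z 0 = 1 := rfl

theorem rising_succ (z : ℚ) (n : ℕ) : rising z (n + 1) = rising z n * (z + n) :=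
  Finset.prod_range_succ _ _

theorem rising_add (z : ℚ) (m n : ℕ) : rising z (m + n) = rising z m * rising (z + m) n := by
  simp only [rising, Finset.prod_range_add]
  congr 1
  refine Finset.prod_congr rfl fun k _ => ?_
  push_cast
  ring

theorem rising_succ_left (z : ℚ) (n : ℕ) : rising z (n + 1) = z * rising (z + 1) n := by
  rw [add_comm, rising_add]
  simp [rising]

theorem rising_pos {z : ℚ} (hz : 0 < z) (n : ℕ) : 0 < rising z n :=
  Finset.prod_pos fun k _ => by positivity

theorem rising_reflect (z : ℚ) (n : ℕ) :
    rising (z - n + 1) n = ∏ k ∈ Finset.range n, (z - k) := by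
  rw [rising, ← Finset.prod_range_reflect]
  refine Finset.prod_congr rfl fun k hk => ?_
  rw [Finset.mem_range] at hk
  rw [Nat.sub_sub, Nat.cast_sub (by omega)]
  push_cast
  ring

theorem binom_eq_rising (N m : ℕ) :
    binom N m = rising ((N : ℚ) - m + 1) m / (m.factorial : ℚ) := by
  rw [binom_natCast, Nat.cast_choose_eq_descPochhammer_div, descPochhammer_eval_eq_prod_range,
    rising_reflect]

open Polynomial in
/-- The monic polynomial with the roots `r 0, …, r (n - 1)`. -/
noncomputable def rootPoly (r : ℕ → ℚ) (n : ℕ) : ℚ[X] := ∏ k ∈ Finset.range n, (X - C (r k))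

theorem rootPoly_monic (r : ℕ → ℚ) (n : ℕ) : (rootPoly r n).Monic :=
  Polynomial.monic_prod_X_sub_C _ _

theorem rootPoly_natDegree (r : ℕ → ℚ) (n : ℕ) : (rootPoly r n).natDegree = n := by
  rw [rootPoly, Polynomial.natDegree_finsetProd_X_sub_C_eq_card, Finset.card_range]

theorem rootPoly_eval (r : ℕ → ℚ) (n : ℕ) (t : ℚ) :
    (rootPoly r n).eval t = ∏ k ∈ Finset.range n, (t - r k) := by
  simp [rootPoly, Polynomial.eval_prod]

/-- The squares of the positive half-integers. -/
def halfSq (k : ℕ) : ℚ := ((k : ℚ) + 1 / 2) ^ 2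

/-- The factors are symmetric about `M + 1/2`; opposite ones multiply to a difference of squares. -/
theorem rising_eq_eval_sq (M : ℚ) (q : ℕ) :
    rising (M - q + 1) (2 * q) = (rootPoly halfSq q).eval ((M + 1 / 2) ^ 2) := by
  rw [rootPoly_eval]
  induction q with
  | zero => simp
  | succ q ih =>
    rw [Finset.prod_range_succ, ← ih, show 2 * (q + 1) = 2 * q + 1 + 1 by ring, rising_succ,
      rising_succ_left, halfSq]
    have : M - ((q + 1 : ℕ) : ℚ) + 1 + 1 = M - q + 1 := by push_cast; ring
    rw [this]
    push_cast
    ring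

/-- Both binomials contain `rising (M - i + 1) (2 * i)`; the cofactors `(M - i) / (2 * i + 1)` and
`1/2` add up to a multiple of `M + 1/2`. -/
theorem halfBinom_eq (M i : ℕ) :
    halfBinom (M + i) (2 * i + 1) =
      ((M : ℚ) + 1 / 2) * (rootPoly halfSq i).eval (((M : ℚ) + 1 / 2) ^ 2) /
        ((2 * i + 1).factorial : ℚ) := by
  have e1 : (2 * (i : ℤ) + 1) = ((2 * i + 1 : ℕ) : ℤ) := by push_cast; ring
  have e2 : (2 * (i : ℤ) + 1) - 1 = ((2 * i : ℕ) : ℤ) := by push_cast; ring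
  rw [halfBinom, e2, e1, binom_eq_rising, binom_eq_rising, ← rising_eq_eval_sq, rising_succ_left,
    Nat.factorial_succ]
  have e3 : ((M + i : ℕ) : ℚ) - ((2 * i + 1 : ℕ) : ℚ) + 1 + 1 = M - i + 1 := by push_cast; ring
  have e4 : ((M + i : ℕ) : ℚ) - ((2 * i : ℕ) : ℚ) + 1 = M - i + 1 := by push_cast; ring
  have h1 : ((2 * i).factorial : ℚ) ≠ 0 := by positivity
  rw [e3, e4]
  push_cast
  have h2 : (2 * (i : ℚ) + 1) ≠ 0 := by positivity
  field_simp
  ring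

theorem binom_eq_eval (M e u : ℕ) :
    binom (M + e) ((2 * e + u : ℕ) : ℤ) =
      rising ((M : ℚ) - e + 1) (2 * e) * (rootPoly (fun k => (e : ℚ) + k) u).eval (M : ℚ) /
        ((2 * e + u).factorial : ℚ) := by
  rw [binom_eq_rising, rootPoly_eval, show 2 * e + u = u + 2 * e by ring, rising_add]
  have e1 : ((M + e : ℕ) : ℚ) - ((u + 2 * e : ℕ) : ℚ) + 1 = ((M : ℚ) - e) - u + 1 := by
    push_cast; ring
  have e2 : ((M : ℚ) - e) - u + 1 + u = (M : ℚ) - e + 1 := by ring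
  rw [e1, e2, rising_reflect, mul_comm (rising _ _)]
  congr 2
  refine Finset.prod_congr rfl fun k _ => ?_
  ring

/-! ### Determinants of monic polynomials and iterated differences -/

open Polynomial in
/-- In a determinant of values of linear functionals on monic polynomials of degrees
`0, 1, …, n - 1`, the polynomials may be replaced by the powers of the variable. -/
theorem det_linear_monic {n : ℕ} (φ : Fin n → ℚ[X] →ₗ[ℚ] ℚ) (p : ℕ → ℚ[X])
    (hm : ∀ i, i < n → (p i).Monic) (hd : ∀ i, i < n → (p i).natDegree = i) :
    Matrix.det (Matrix.of fun i l : Fin n => φ l (p i)) =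
      Matrix.det (Matrix.of fun i l : Fin n => φ l (X ^ (i : ℕ))) := by
  have hC : Matrix.det (Matrix.of fun i j : Fin n => (p i).coeff j) = 1 := by
    rw [Matrix.det_of_isLowerTriangular]
    · refine Finset.prod_eq_one fun i _ => ?_
      have := hm i i.2
      rw [Polynomial.Monic, Polynomial.leadingCoeff, hd i i.2] at this
      exact this
    · intro i j hij
      have : (i : ℕ) < j := hij
      refine Polynomial.coeff_eq_zero_of_natDegree_lt ?_
      rw [hd i i.2]
      exact this
  rw [← one_mul (Matrix.det (Matrix.of fun i l : Fin n => φ l (X ^ (i : ℕ)))), ← hC,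
    ← Matrix.det_mul]
  congr 1
  ext i l
  rw [Matrix.mul_apply, Matrix.of_apply, (p i).as_sum_range' n (by rw [hd i i.2]; exact i.2),
    map_sum, Finset.sum_range]
  refine Finset.sum_congr rfl fun j _ => ?_
  rw [← Polynomial.C_mul_X_pow_eq_monomial, ← Polynomial.smul_eq_C_mul, map_smul]
  rfl

/-- The numerator is the midpoint of the factors in the denominator, a shape preserved by
differences: for `n` factors starting at `w`, the difference of `(2w + n - 1) / rising w n` is `-(n
- 1) (2w + n) / rising w (n + 1)`. Here `n = 2 * q + b`. -/
theorem fwdDiff_iter_ratio {z : ℚ} (hz : 0 < z) (q b : ℕ) :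
    (fwdDiff (1 : ℕ))^[b] (fun l : ℕ => (z + l + q - 1 / 2) / rising (z + l) (2 * q)) =
      fun l : ℕ => (1 / 2 * ∏ j ∈ Finset.range b, (-(2 * q - 1 + j) : ℚ)) *
        ((2 * (z + l) + 2 * q - 1 + b) / rising (z + l) (2 * q + b)) := by
  induction b with
  | zero =>
    ext l
    have := (rising_pos (show 0 < z + l by positivity) (2 * q)).ne'
    simp only [Function.iterate_zero, id, Finset.range_zero, Finset.prod_empty, add_zero]
    field_simp
    push_cast
    ring
  | succ b ih =>
    rw [Function.iterate_succ_apply', ih]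
    ext l
    rw [fwdDiff, Finset.prod_range_succ]
    set w : ℚ := z + l with hw
    have hw0 : 0 < w := by positivity
    have e1 : z + ((l + 1 : ℕ) : ℚ) = w + 1 := by push_cast; ring
    rw [e1]
    have h1 := (rising_pos hw0 (2 * q + b)).ne'
    have h2 := (rising_pos (show 0 < w + 1 by positivity) (2 * q + b)).ne'
    have h3 : rising w (2 * q + (b + 1)) = rising w (2 * q + b) * (w + ((2 * q + b : ℕ) : ℚ)) :=
      rising_succ _ _
    have h4 : rising w (2 * q + (b + 1)) = w * rising (w + 1) (2 * q + b) :=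
      rising_succ_left _ _
    have h5 : 0 < w + ((2 * q + b : ℕ) : ℚ) := by positivity
    have h6 : rising (w + 1) (2 * q + b) =
        rising w (2 * q + b) * (w + ((2 * q + b : ℕ) : ℚ)) / w := by
      rw [eq_div_iff hw0.ne', ← h3, h4, mul_comm]
    rw [h3, h6]
    push_cast at h5 ⊢
    have h7 := h5.ne'
    field_simp
    ring

/-- The matrix which replaces the first `c` columns of a matrix by their `b`-th differences. -/
def diffMatrix (b c : ℕ) : Matrix (Fin (c + b)) (Fin (c + b)) ℚ :=
  Matrix.of fun j l : Fin (c + b) =>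
    if (l : ℕ) < c then
      if (l : ℕ) ≤ j then (((-1 : ℤ) ^ (b - (j - l)) * (b.choose (j - l) : ℤ) : ℤ) : ℚ) else 0
    else if j = l then 1 else 0

theorem det_diffMatrix_ne_zero (b c : ℕ) : (diffMatrix b c).det ≠ 0 := by
  rw [Matrix.det_of_isLowerTriangular]
  · refine Finset.prod_ne_zero_iff.2 fun i _ => ?_
    simp only [diffMatrix, Matrix.of_apply, le_refl, if_true, Nat.sub_self, Nat.choose_zero_right]
    split_ifs <;> simp
  · intro i j hij
    have : (i : ℕ) < j := hij
    simp only [diffMatrix, Matrix.of_apply]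
    have hne : i ≠ j := fun h => by rw [h] at this; exact lt_irrefl _ this
    simp [not_le.2 this, hne]

theorem sum_mul_diffMatrix (b c : ℕ) (f : ℕ → ℚ) (l : Fin (c + b)) :
    ∑ j : Fin (c + b), f j * diffMatrix b c j l =
      if (l : ℕ) < c then (fwdDiff (1 : ℕ))^[b] f l else f l := by
  simp only [diffMatrix, Matrix.of_apply]
  by_cases hl : (l : ℕ) < c
  · obtain ⟨l, hl'⟩ := l
    dsimp only at hl
    simp only [if_pos hl]
    -- As `l < c`, the window from `l` to `l + b` used by the difference lies within the `c + b`
    -- columns; the entries on either side of it vanish.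
    rw [fwdDiff_iter_eq_sum_shift, ← Finset.sum_range (n := c + b) (fun j : ℕ => f j *
      (if l ≤ j then (((-1 : ℤ) ^ (b - (j - l)) * (b.choose (j - l) : ℤ) : ℤ) : ℚ) else 0)),
      show c + b = l + ((b + 1) + (c - 1 - l)) by omega, Finset.sum_range_add,
      Finset.sum_range_add]
    rw [Finset.sum_eq_zero, zero_add, Finset.sum_eq_zero (s := Finset.range (c - 1 - l)), add_zero]
    · refine Finset.sum_congr rfl fun k _ => ?_
      rw [if_pos (by omega), Nat.add_sub_cancel_left, zsmul_eq_mul, mul_comm]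
      simp
    · intro k _
      rw [if_pos (by omega), Nat.choose_eq_zero_of_lt (by omega)]
      simp
    · intro k hk
      rw [if_neg (by simpa using hk), mul_zero]
  · simp only [if_neg hl]
    simp

theorem det_eval_monic {n : ℕ} (v : ℕ → ℚ) (p : ℕ → Polynomial ℚ)
    (hm : ∀ i, i < n → (p i).Monic) (hd : ∀ i, i < n → (p i).natDegree = i) :
    Matrix.det (Matrix.of fun i l : Fin n => (p i).eval (v l)) =
      ∏ i : Fin n, ∏ j ∈ Finset.Ioi i, (v j - v i) := by
  have := det_linear_monic (fun l : Fin n => Polynomial.leval (v l)) p hm hd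
  simp only [Polynomial.leval_apply, Polynomial.eval_pow, Polynomial.eval_X] at this
  rw [this, ← Matrix.det_vandermonde, ← Matrix.det_transpose]
  rfl

theorem rising_middle (w : ℚ) (n s : ℕ) :
    rising w (2 * s + n) =
      rising (w + s) n * ∏ k ∈ Finset.range s, ((w + k) * (w + 2 * s + n - 1 - k)) := by
  have e : w + ((s + n : ℕ) : ℚ) = (w + 2 * s + n - 1) - s + 1 := by push_cast; ring
  rw [show 2 * s + n = (s + n) + s by ring, rising_add, rising_add, e, rising_reflect,
    Finset.prod_mul_distrib, ← rising]
  ring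

/-! ### The determinant for `c ≤ x` -/

/-- The common factor of the `l`-th column. -/
def colFactor (x a c l : ℕ) : ℚ := rising (((x + a + l : ℕ) : ℚ) - (a + c : ℕ) + 1) (2 * (a + c))

theorem colFactor_pos {x a c : ℕ} (hx : c ≤ x) (l : ℕ) : 0 < colFactor x a c l := by
  refine rising_pos ?_ _
  have : (c : ℚ) ≤ x := by exact_mod_cast hx
  push_cast
  have : (0 : ℚ) ≤ l := by positivity
  linarith

/-- The entries of the column-reduced tiling matrix divided by the column factors. -/
noncomputable def reducedEntry (x a c i l : ℕ) : ℚ :=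
  if i < c then
    (((x + a + l : ℕ) : ℚ) + 1 / 2) / colFactor x a c l *
      (rootPoly halfSq i).eval ((((x + a + l : ℕ) : ℚ) + 1 / 2) ^ 2) * (1 / ((2 * i + 1).factorial : ℚ))
  else 1 / ((2 * (a + c) + (i - c)).factorial : ℚ) *
    (rootPoly (fun k => ((a + c : ℕ) : ℚ) + k) (i - c)).eval ((x + a + l : ℕ) : ℚ)

theorem det_tilingMatrix_eq_reduced {x a b c : ℕ} (hx : c ≤ x) :
    (tilingMatrix x a b c).det = (∏ l : Fin (c + b), colFactor x a c l) *
      Matrix.det (Matrix.of fun i l : Fin (c + b) => reducedEntry x a c i l) := by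
  rw [det_tilingMatrix_eq, ← Matrix.det_mul_row]
  congr 1
  ext i l
  simp only [Matrix.of_apply, reducedEntry]
  have hQ := (colFactor_pos (a := a) hx l).ne'
  split_ifs with hi
  · rw [show x + a + (i : ℕ) + l = (x + a + l) + i by ring, halfBinom_eq]
    field_simp
  · have e : (2 * a + c + (i : ℕ) : ℤ) = ((2 * (a + c) + (i - c) : ℕ) : ℤ) := by omega
    rw [show x + 2 * a + c + (l : ℕ) = (x + a + l) + (a + c) by ring, e, binom_eq_eval, colFactor]
    ring

theorem fwdDiff_iter_eval (p : Polynomial ℚ) (b m : ℕ) (hp : p.natDegree < b) (l : ℕ) :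
    (fwdDiff (1 : ℕ))^[b] (fun l : ℕ => p.eval ((m + l : ℕ) : ℚ)) l = 0 := by
  have := congrFun (Polynomial.fwdDiff_iter_eq_zero_of_degree_lt hp) ((m + l : ℕ) : ℚ)
  rw [fwdDiff_iter_eq_sum_shift] at this ⊢
  rw [Pi.zero_apply] at this
  rw [← this]
  refine Finset.sum_congr rfl fun k _ => ?_
  congr 2
  simp
  ring

/-- The lower rows are polynomials of degree less than `b` in the column index, so their `b`-th
differences vanish and the product is block triangular. The determinant of `diffMatrix` is kept as a
factor, since only its independence of `x` matters. -/
theorem det_reducedEntry_mul (x a b c : ℕ) :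
    Matrix.det (Matrix.of fun i l : Fin (c + b) => reducedEntry x a c i l) *
        (diffMatrix b c).det =
      Matrix.det (Matrix.of fun i l : Fin c =>
        (fwdDiff (1 : ℕ))^[b] (fun l => reducedEntry x a c i l) l) *
      Matrix.det (Matrix.of fun u l : Fin b => reducedEntry x a c (c + u) (c + l)) := by
  rw [← Matrix.det_mul]
  have : (Matrix.of fun i l : Fin (c + b) => reducedEntry x a c i l) * diffMatrix b c =
      Matrix.of fun i l : Fin (c + b) =>
        if (l : ℕ) < c then (fwdDiff (1 : ℕ))^[b] (fun l => reducedEntry x a c i l) l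
        else reducedEntry x a c i l := by
    ext i l
    rw [Matrix.mul_apply]
    exact sum_mul_diffMatrix b c (fun l => reducedEntry x a c i l) l
  rw [this, ← Matrix.det_submatrix_equiv_self finSumFinEquiv]
  set A := (Matrix.of fun i l : Fin (c + b) =>
        if (l : ℕ) < c then (fwdDiff (1 : ℕ))^[b] (fun l => reducedEntry x a c i l) l
        else reducedEntry x a c i l).submatrix finSumFinEquiv finSumFinEquiv with hA
  have h21 : A.toBlocks₂₁ = 0 := by
    ext u l
    simp only [hA, Matrix.toBlocks₂₁, Matrix.submatrix_apply, Matrix.of_apply,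
      finSumFinEquiv_apply_left, finSumFinEquiv_apply_right, Fin.val_natAdd, Fin.val_castAdd,
      Matrix.zero_apply, if_pos l.2, reducedEntry]
    simp only [if_neg (show ¬ c + (u : ℕ) < c by omega), Nat.add_sub_cancel_left]
    rw [← fwdDiff_iter_eval (Polynomial.C (1 / ((2 * (a + c) + u).factorial : ℚ)) *
      rootPoly (fun k => ((a + c : ℕ) : ℚ) + k) u) b (x + a) ?_ l]
    · simp
    · refine lt_of_le_of_lt (Polynomial.natDegree_C_mul_le _ _) ?_
      rw [rootPoly_natDegree]
      exact u.2
  rw [← Matrix.fromBlocks_toBlocks A, h21, Matrix.det_fromBlocks_zero₂₁]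
  congr 2
  · ext i l
    simp [hA, Matrix.toBlocks₁₁]
  · ext i l
    simp [hA, Matrix.toBlocks₂₂]

theorem det_reducedEntry_right (x a b c : ℕ) :
    Matrix.det (Matrix.of fun u l : Fin b => reducedEntry x a c (c + u) (c + l)) =
      (∏ u : Fin b, 1 / ((2 * (a + c) + u).factorial : ℚ)) *
        ∏ i : Fin b, ∏ j ∈ Finset.Ioi i, ((j : ℚ) - (i : ℚ)) := by
  have h := det_eval_monic (n := b) (fun l => ((x + a + (c + l) : ℕ) : ℚ))
    (fun u => rootPoly (fun k => ((a + c : ℕ) : ℚ) + k) u)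
    (fun _ _ => rootPoly_monic _ _) (fun _ _ => rootPoly_natDegree _ _)
  have e : ∀ i j : Fin b, ((x + a + (c + j) : ℕ) : ℚ) - ((x + a + (c + i) : ℕ) : ℚ) =
      (j : ℚ) - (i : ℚ) := by
    intro i j
    push_cast
    ring
  simp only [e] at h
  rw [← h, ← Matrix.det_mul_column]
  congr 1
  ext u l
  simp [reducedEntry]

/-- The abscissa, from the point of symmetry, belonging to the `l`-th column. -/
def symPos (x a b l : ℕ) : ℚ := ((x + a + l : ℕ) : ℚ) + ((b : ℚ) + 1) / 2

/-- Row `i` is a linear functional, depending on the column, of a monic polynomial of degree `i` in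
`(M + 1/2) ^ 2`, so any other monic polynomials of these degrees may be used. A choice dividing
`colFactor` leaves a ratio with explicit differences. Over a common denominator, symmetric about
`-(b + 1) / 2` as a function of `M`, these become monic polynomials in `symPos ^ 2`: a Vandermonde
determinant. -/
theorem det_reducedEntry_left {x a b c : ℕ} (hx : c ≤ x) :
    Matrix.det (Matrix.of fun i l : Fin c =>
        (fwdDiff (1 : ℕ))^[b] (fun l => reducedEntry x a c i l) l) =
      (∏ i : Fin c, 1 / ((2 * (i : ℕ) + 1).factorial : ℚ)) *
      (∏ s : Fin c, (1 / 2 * ∏ j ∈ Finset.range b, (-(2 * (a + c - s : ℕ) - 1 + j) : ℚ))) *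
      (∏ l : Fin c, 2 * symPos x a b l /
        rising (((x + a + l : ℕ) : ℚ) - (a + c : ℕ) + 1) (2 * (a + c) + b)) *
      ∏ i : Fin c, ∏ j ∈ Finset.Ioi i, (symPos x a b j ^ 2 - symPos x a b i ^ 2) := by
  set e : ℕ := a + c with he
  set M : ℕ → ℚ := fun l => ((x + a + l : ℕ) : ℚ) with hM
  -- The `b`-th difference at `l`, written as a linear functional of the polynomial factor.
  let φ : Fin c → Polynomial ℚ →ₗ[ℚ] ℚ := fun l =>
    ∑ k ∈ Finset.range (b + 1), (((-1 : ℤ) ^ (b - k) * b.choose k : ℤ) : ℚ) •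
      ((M (l + k) + 1 / 2) / colFactor x a c (l + k)) •
        Polynomial.leval ((M (l + k) + 1 / 2) ^ 2)
  have hφ : ∀ l p, φ l p = (fwdDiff (1 : ℕ))^[b]
      (fun l => (M l + 1 / 2) / colFactor x a c l * p.eval ((M l + 1 / 2) ^ 2)) l := by
    intro l p
    rw [fwdDiff_iter_eq_sum_shift]
    simp only [φ, LinearMap.sum_apply, LinearMap.smul_apply, Polynomial.leval_apply, smul_eq_mul,
      mul_one, zsmul_eq_mul]
  have h1 : (Matrix.of fun i l : Fin c =>
        (fwdDiff (1 : ℕ))^[b] (fun l => reducedEntry x a c i l) l) =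
      Matrix.of fun i l : Fin c => 1 / ((2 * (i : ℕ) + 1).factorial : ℚ) *
        (Matrix.of fun i l : Fin c => φ l (rootPoly halfSq i)) i l := by
    ext i l
    simp only [Matrix.of_apply, hφ, reducedEntry, if_pos i.2]
    rw [← smul_eq_mul (1 / ((2 * (i : ℕ) + 1).factorial : ℚ)), ← Pi.smul_apply,
      ← fwdDiff_iter_const_smul]
    refine congrArg (fun f => (fwdDiff (1 : ℕ))^[b] f (l : ℕ)) (funext fun l => ?_)
    simp only [Pi.smul_apply, smul_eq_mul]
    ring
  rw [h1, Matrix.det_mul_column, mul_assoc, mul_assoc]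
  congr 1
  -- Via the powers of the variable, pass to the polynomials formed by the outermost `s` pairs of
  -- factors of `colFactor`; they cancel, leaving the middle `2 * (e - s)` factors.
  rw [det_linear_monic φ (fun i => rootPoly halfSq i) (fun _ _ => rootPoly_monic _ _)
      (fun _ _ => rootPoly_natDegree _ _),
    ← det_linear_monic φ (fun s => rootPoly (fun k => halfSq (e - s + k)) s)
      (fun _ _ => rootPoly_monic _ _) (fun _ _ => rootPoly_natDegree _ _)]
  have hsplit : ∀ s : Fin c, ∀ l, colFactor x a c l =
      rising (M l - (e - s : ℕ) + 1) (2 * (e - s)) *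
        (rootPoly (fun k => halfSq (e - s + k)) s).eval ((M l + 1 / 2) ^ 2) := by
    intro s l
    rw [colFactor, rising_eq_eval_sq, rising_eq_eval_sq, rootPoly_eval, rootPoly_eval,
      rootPoly_eval, ← Finset.prod_range_add]
    congr 2
    omega
  have hMl : ∀ l, M l = ((x + a : ℕ) : ℚ) + l := fun l => by simp [hM]
  have hval : ∀ s l : Fin c, φ l (rootPoly (fun k => halfSq (e - s + k)) s) =
      (1 / 2 * ∏ j ∈ Finset.range b, (-(2 * (e - s : ℕ) - 1 + j) : ℚ)) *
        ((2 * symPos x a b l) / rising (M l - (e - s : ℕ) + 1) (2 * (e - s) + b)) := by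
    intro s l
    have hz : (0 : ℚ) < ((x + a : ℕ) : ℚ) - (e - s : ℕ) + 1 := by
      have : ((e - s : ℕ) : ℚ) < ((x + a : ℕ) : ℚ) + 1 := by
        exact_mod_cast (show e - s < x + a + 1 by omega)
      linarith
    have h2 := congrFun (fwdDiff_iter_ratio hz (e - s) b) l
    rw [hφ]
    convert h2 using 2
    · ext l
      have hQ := (colFactor_pos (a := a) hx l).ne'
      rw [hsplit s l] at hQ ⊢
      have h3 := left_ne_zero_of_mul hQ
      have h4 := right_ne_zero_of_mul hQ
      have e1 : ((x + a : ℕ) : ℚ) - (e - s : ℕ) + 1 + l = M l - (e - s : ℕ) + 1 := by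
        rw [hMl]; ring
      rw [e1]
      generalize (rootPoly (fun k => halfSq (e - s + k)) s).eval ((M l + 1 / 2) ^ 2) = t at h4 ⊢
      field_simp
      ring
    · have e1 : ((x + a : ℕ) : ℚ) - (e - s : ℕ) + 1 + l = M l - (e - s : ℕ) + 1 := by
        rw [hMl]; ring
      rw [e1]
      congr 1
      rw [symPos]
      change 2 * (M l + ((b : ℚ) + 1) / 2) = _
      ring
  -- The `s` missing factors at each end pair up, by `rising_middle`, to differences of squares
  -- around `symPos`.
  have hden : ∀ s l : Fin c,
      1 / rising (M l - (e - s : ℕ) + 1) (2 * (e - s) + b) =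
        1 / rising (M l - e + 1) (2 * e + b) *
          (rootPoly (fun k => ((e : ℚ) + ((b : ℚ) - 1) / 2 - k) ^ 2) s).eval
            (symPos x a b l ^ 2) := by
    intro s l
    have hs : ((e - s : ℕ) : ℚ) = (e : ℚ) - s := by
      rw [Nat.cast_sub (by omega)]
    have h3 := rising_middle (M l - e + 1) (2 * (e - s) + b) s
    have e2 : 2 * (s : ℕ) + (2 * (e - s) + b) = 2 * e + b := by omega
    have e3 : M l - e + 1 + s = M l - (e - s : ℕ) + 1 := by rw [hs]; ring
    have hpos : 0 < M l - e + 1 := by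
      have : (e : ℚ) < M l + 1 := by
        change (e : ℚ) < ((x + a + l : ℕ) : ℚ) + 1
        exact_mod_cast (show e < x + a + l + 1 by omega)
      linarith
    have h4 := (rising_pos hpos (2 * e + b)).ne'
    rw [e2, e3] at h3
    rw [h3] at h4 ⊢
    have h5 := left_ne_zero_of_mul h4
    have h6 := right_ne_zero_of_mul h4
    rw [rootPoly_eval]
    have h7 : ∏ k ∈ Finset.range s,
        (symPos x a b l ^ 2 - ((e : ℚ) + ((b : ℚ) - 1) / 2 - k) ^ 2) =
        ∏ k ∈ Finset.range s, ((M l - e + 1 + k) * (M l - e + 1 + 2 * s +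
          (2 * (e - s) + b : ℕ) - 1 - k)) := by
      refine Finset.prod_congr rfl fun k _ => ?_
      have hsp : symPos x a b l = M l + ((b : ℚ) + 1) / 2 := rfl
      rw [hsp]
      push_cast [hs]
      ring
    rw [h7, div_mul_eq_mul_div, one_mul, div_eq_div_iff h5 h4]
    ring
  have h2 : (Matrix.of fun s l : Fin c => φ l (rootPoly (fun k => halfSq (e - s + k)) s)) =
      Matrix.of fun s l : Fin c =>
        (1 / 2 * ∏ j ∈ Finset.range b, (-(2 * (e - s : ℕ) - 1 + j) : ℚ)) *
        (Matrix.of fun s l : Fin c =>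
          (2 * symPos x a b l / rising (M l - e + 1) (2 * e + b)) *
          (Matrix.of fun s l : Fin c =>
            (rootPoly (fun k => ((e : ℚ) + ((b : ℚ) - 1) / 2 - k) ^ 2) s).eval
              (symPos x a b l ^ 2)) s l) s l := by
    ext s l
    simp only [Matrix.of_apply]
    rw [hval, div_eq_mul_one_div (2 * symPos x a b l), hden,
      div_eq_mul_one_div (2 * symPos x a b l)]
    ring
  rw [h2, Matrix.det_mul_column, Matrix.det_mul_row]
  rw [det_eval_monic (fun l => symPos x a b l ^ 2)
    (fun s => rootPoly (fun k => ((e : ℚ) + ((b : ℚ) - 1) / 2 - k) ^ 2) s)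
    (fun _ _ => rootPoly_monic _ _) (fun _ _ => rootPoly_natDegree _ _)]

/-- The product of `z + i + j` over all `i ≤ j < c`. -/
def pairProd : ℕ → ℚ → ℚ
  | 0, _ => 1
  | c + 1, z => rising z (c + 1) * pairProd c (z + 2)

/-- Needed at `z = 2 * a + b + 1`, to divide by the value at `x = 0`. -/
theorem pairProd_pos (c : ℕ) {z : ℚ} (hz : 0 < z) : 0 < pairProd c z := by
  induction c generalizing z with
  | zero => exact one_pos
  | succ c ih => exact mul_pos (rising_pos hz _) (ih (by positivity))

theorem prod_pairs_eq_pairProd (c : ℕ) (z : ℚ) :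
    (∏ l : Fin c, (z + 2 * (l : ℕ))) * ∏ i : Fin c, ∏ j ∈ Finset.Ioi i, (z + (i : ℕ) + (j : ℕ)) =
      pairProd c z := by
  induction c generalizing z with
  | zero => simp [pairProd]
  | succ c ih =>
    rw [pairProd, ← ih, Fin.prod_univ_succ, Fin.prod_univ_succ, Fin.prod_Ioi_zero,
      rising_succ_left, rising, Finset.prod_range]
    have h1 : ∀ l : Fin c, z + 2 * ((l.succ : Fin (c + 1)) : ℕ) = z + 2 + 2 * (l : ℕ) := by
      intro l
      push_cast [Fin.val_succ]
      ring
    have h2 : ∀ i j : Fin c, z + ((i.succ : Fin (c + 1)) : ℕ) + ((j.succ : Fin (c + 1)) : ℕ) =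
        z + 2 + (i : ℕ) + (j : ℕ) := by
      intro i j
      push_cast [Fin.val_succ]
      ring
    have h3 : ∀ j : Fin c, z + ((0 : Fin (c + 1)) : ℕ) + ((j.succ : Fin (c + 1)) : ℕ) =
        z + 1 + (j : ℕ) := by
      intro j
      simp [Fin.val_succ]
      ring
    simp only [Fin.prod_Ioi_succ, h1, h2, h3]
    simp
    ring

theorem symPos_sq_sub (x a b i j : ℕ) :
    symPos x a b j ^ 2 - symPos x a b i ^ 2 =
      ((j : ℚ) - i) * ((2 * x + 2 * a + b + 1 : ℚ) + i + j) := by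
  simp only [symPos]
  push_cast
  ring

theorem prod_symPos (x a b c : ℕ) :
    (∏ l : Fin c, 2 * symPos x a b l) *
      ∏ i : Fin c, ∏ j ∈ Finset.Ioi i, (symPos x a b j ^ 2 - symPos x a b i ^ 2) =
    (∏ i : Fin c, ∏ j ∈ Finset.Ioi i, ((j : ℚ) - (i : ℚ))) *
      pairProd c (2 * x + 2 * a + b + 1) := by
  simp only [symPos_sq_sub, Finset.prod_mul_distrib]
  rw [← prod_pairs_eq_pairProd]
  have : ∀ l : Fin c, 2 * symPos x a b l = (2 * x + 2 * a + b + 1 : ℚ) + 2 * (l : ℕ) := by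
    intro l
    simp only [symPos]
    push_cast
    ring
  simp only [← this, Finset.prod_mul_distrib]
  ring

/-- `K` collects all factors free of `x`. The denominators are moved to the left, so that both sides
are polynomial in `x`. -/
theorem exists_det_tilingMatrix_of_le (a b c : ℕ) : ∃ K : ℚ, ∀ x, c ≤ x →
    (tilingMatrix x a b c).det *
        ∏ l ∈ Finset.range c, rising (x + (2 * a + c + l + 1 : ℕ)) b =
      K * ((∏ l ∈ Finset.range b, rising (x + (l + 1 : ℕ)) (2 * (a + c))) *
        pairProd c (2 * x + 2 * a + b + 1)) := by
  refine ⟨(diffMatrix b c).det⁻¹ * ((∏ i : Fin c, 1 / ((2 * (i : ℕ) + 1).factorial : ℚ)) *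
      (∏ s : Fin c, (1 / 2 * ∏ j ∈ Finset.range b, (-(2 * (a + c - s : ℕ) - 1 + j) : ℚ))) *
      ((∏ u : Fin b, 1 / ((2 * (a + c) + u).factorial : ℚ)) *
        ∏ i : Fin b, ∏ j ∈ Finset.Ioi i, ((j : ℚ) - (i : ℚ))) *
      ∏ i : Fin c, ∏ j ∈ Finset.Ioi i, ((j : ℚ) - (i : ℚ))), fun x hx => ?_⟩
  have hE := det_diffMatrix_ne_zero b c
  have h := det_reducedEntry_mul x a b c
  rw [det_reducedEntry_right, det_reducedEntry_left hx] at h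
  have h' := (eq_mul_inv_iff_mul_eq₀ hE).2 h
  rw [det_tilingMatrix_eq_reduced hx, h', Fin.prod_univ_add]
  have hright : ∏ l : Fin b, colFactor x a c (Fin.natAdd c l : Fin (c + b)) =
      ∏ l ∈ Finset.range b, rising (x + (l + 1 : ℕ)) (2 * (a + c)) := by
    rw [Finset.prod_range]
    refine Finset.prod_congr rfl fun l _ => ?_
    rw [colFactor, Fin.val_natAdd]
    congr 1
    push_cast
    ring
  have hleft : (∏ l : Fin c, colFactor x a c (Fin.castAdd b l : Fin (c + b))) *
      (∏ l : Fin c, 2 * symPos x a b l /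
        rising (((x + a + l : ℕ) : ℚ) - (a + c : ℕ) + 1) (2 * (a + c) + b)) *
      ∏ l ∈ Finset.range c, rising (x + (2 * a + c + l + 1 : ℕ)) b =
        ∏ l : Fin c, 2 * symPos x a b l := by
    rw [Finset.prod_range, ← Finset.prod_mul_distrib, ← Finset.prod_mul_distrib]
    refine Finset.prod_congr rfl fun l _ => ?_
    have hQ := (colFactor_pos (a := a) hx l).ne'
    rw [Fin.val_castAdd]
    rw [rising_add, ← colFactor]
    have e : (((x + a + l : ℕ) : ℚ) - (a + c : ℕ) + 1) + (2 * (a + c) : ℕ) =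
        x + (2 * a + c + l + 1 : ℕ) := by
      push_cast; ring
    have hR := (rising_pos (show (0 : ℚ) < x + (2 * a + c + l + 1 : ℕ) by positivity) b).ne'
    rw [e]
    field_simp
  rw [hright]
  have hS := prod_symPos x a b c
  rw [← hleft] at hS
  linear_combination (diffMatrix b c).det⁻¹ *
    (∏ i : Fin c, 1 / ((2 * (i : ℕ) + 1).factorial : ℚ)) *
      (∏ s : Fin c, (1 / 2 * ∏ j ∈ Finset.range b, (-(2 * (a + c - s : ℕ) - 1 + j) : ℚ))) *
      ((∏ u : Fin b, 1 / ((2 * (a + c) + u).factorial : ℚ)) *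
        ∏ i : Fin b, ∏ j ∈ Finset.Ioi i, ((j : ℚ) - (i : ℚ))) *
      (∏ l ∈ Finset.range b, rising (x + (l + 1 : ℕ)) (2 * (a + c))) * hS

/-! ### Extension to all `x` by polynomiality -/

open Polynomial in
/-- A function on the natural numbers given by a polynomial. -/
def IsPolyFun (f : ℕ → ℚ) : Prop := ∃ P : ℚ[X], ∀ x : ℕ, f x = P.eval (x : ℚ)

namespace IsPolyFun

theorem const (r : ℚ) : IsPolyFun fun _ => r := ⟨Polynomial.C r, fun x => by simp⟩

theorem natCast : IsPolyFun fun x => (x : ℚ) := ⟨Polynomial.X, fun x => by simp⟩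

theorem add {f g : ℕ → ℚ} (hf : IsPolyFun f) (hg : IsPolyFun g) :
    IsPolyFun fun x => f x + g x := by
  obtain ⟨P, hP⟩ := hf
  obtain ⟨Q, hQ⟩ := hg
  exact ⟨P + Q, fun x => by simp [hP, hQ]⟩

theorem mul {f g : ℕ → ℚ} (hf : IsPolyFun f) (hg : IsPolyFun g) :
    IsPolyFun fun x => f x * g x := by
  obtain ⟨P, hP⟩ := hf
  obtain ⟨Q, hQ⟩ := hg
  exact ⟨P * Q, fun x => by simp [hP, hQ]⟩

theorem sum {ι : Type*} (s : Finset ι) {f : ι → ℕ → ℚ} (hf : ∀ i, IsPolyFun (f i)) :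
    IsPolyFun fun x => ∑ i ∈ s, f i x := by
  choose P hP using hf
  exact ⟨∑ i ∈ s, P i, fun x => by simp [hP, Polynomial.eval_finsetSum]⟩

theorem prod {ι : Type*} (s : Finset ι) {f : ι → ℕ → ℚ} (hf : ∀ i, IsPolyFun (f i)) :
    IsPolyFun fun x => ∏ i ∈ s, f i x := by
  choose P hP using hf
  exact ⟨∏ i ∈ s, P i, fun x => by simp [hP, Polynomial.eval_prod]⟩

theorem rising {f : ℕ → ℚ} (hf : IsPolyFun f) (n : ℕ) :
    IsPolyFun fun x => ZigzagTiling.rising (f x) n :=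
  prod _ fun k => hf.add (const k)

theorem binom (k : ℕ) (m : ℤ) : IsPolyFun fun x => ZigzagTiling.binom (x + k) m := by
  rcases lt_or_ge m 0 with hm | hm
  · simp only [binom_of_neg hm]
    exact const 0
  · obtain ⟨m, rfl⟩ := Int.eq_ofNat_of_zero_le hm
    have : (fun x => ZigzagTiling.binom (x + k) m) = fun x : ℕ =>
        ZigzagTiling.rising ((x : ℚ) + (k - m + 1)) m * (m.factorial : ℚ)⁻¹ := by
      ext x
      rw [binom_eq_rising, div_eq_mul_inv]
      congr 2
      push_cast
      ring
    exact this ▸ ((natCast.add (const _)).rising m).mul (const _)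

theorem det {n : ℕ} {A : ℕ → Matrix (Fin n) (Fin n) ℚ} (hA : ∀ i j, IsPolyFun fun x => A x i j) :
    IsPolyFun fun x => (A x).det := by
  simp only [Matrix.det_apply']
  exact sum _ fun σ => (const _).mul (prod _ fun i => hA _ _)

theorem pairProd {f : ℕ → ℚ} (hf : IsPolyFun f) (c : ℕ) :
    IsPolyFun fun x => ZigzagTiling.pairProd c (f x) := by
  induction c generalizing f with
  | zero => exact const 1
  | succ c ih => exact (hf.rising _).mul (ih (hf.add (const 2)))

theorem eq_of_eventually {f g : ℕ → ℚ} (hf : IsPolyFun f) (hg : IsPolyFun g) {c : ℕ}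
    (h : ∀ x, c ≤ x → f x = g x) (x : ℕ) : f x = g x := by
  obtain ⟨P, hP⟩ := hf
  obtain ⟨Q, hQ⟩ := hg
  have : P = Q := by
    refine Polynomial.eq_of_infinite_eval_eq P Q ?_
    refine Set.Infinite.mono (s := (fun n : ℕ => (n : ℚ)) '' Set.Ici c) ?_
      ((Set.Ici_infinite c).image (Nat.cast_injective.injOn))
    rintro _ ⟨n, hn, rfl⟩
    change P.eval (n : ℚ) = Q.eval (n : ℚ)
    rw [← hP, ← hQ, h n hn]
  rw [hP, hQ, this]

end IsPolyFun

theorem isPolyFun_det_tilingMatrix (a b c : ℕ) :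
    IsPolyFun fun x => (tilingMatrix x a b c).det := by
  refine IsPolyFun.det fun i j => ?_
  simp only [tilingMatrix, Matrix.of_apply]
  split_ifs
  · simp only [halfBinom, add_assoc]
    exact (IsPolyFun.binom _ _).add ((IsPolyFun.const _).mul (IsPolyFun.binom _ _))
  · simp only [add_assoc]
    exact IsPolyFun.binom _ _

theorem exists_det_tilingMatrix (a b c : ℕ) : ∃ K : ℚ, ∀ x : ℕ,
    (tilingMatrix x a b c).det *
        ∏ l ∈ Finset.range c, rising (x + (2 * a + c + l + 1 : ℕ)) b =
      K * ((∏ l ∈ Finset.range b, rising (x + (l + 1 : ℕ)) (2 * (a + c))) *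
        pairProd c (2 * x + 2 * a + b + 1)) := by
  obtain ⟨K, hK⟩ := exists_det_tilingMatrix_of_le a b c
  have hx := IsPolyFun.natCast
  refine ⟨K, fun x => IsPolyFun.eq_of_eventually (c := c) ?_ ?_ hK x⟩
  · exact (isPolyFun_det_tilingMatrix a b c).mul
      (IsPolyFun.prod _ fun l => (hx.add (IsPolyFun.const _)).rising b)
  · refine (IsPolyFun.const K).mul ((IsPolyFun.prod _ fun l =>
      (hx.add (IsPolyFun.const _)).rising _).mul (IsPolyFun.pairProd ?_ c))
    exact ((((IsPolyFun.const 2).mul hx).add (IsPolyFun.const _)).add (IsPolyFun.const _)).add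
      (IsPolyFun.const _)

/-- Rearrangement of the products of rising factorials in the determinant. -/
theorem prod_rising_rearrange (x a b c : ℕ) :
    ∏ l ∈ Finset.range b, rising (x + (l + 1 : ℕ)) (2 * (a + c)) =
      (∏ l ∈ Finset.range b, rising (x + (l + 1 : ℕ)) (2 * a + c)) *
        ∏ l ∈ Finset.range c, rising (x + (2 * a + c + l + 1 : ℕ)) b := by
  have h1 : ∀ l : ℕ, rising (x + (l + 1 : ℕ)) (2 * (a + c)) =
      rising (x + (l + 1 : ℕ)) (2 * a + c) * rising (x + (2 * a + c + l + 1 : ℕ)) c := by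
    intro l
    rw [show 2 * (a + c) = 2 * a + c + c by ring, rising_add]
    congr 2
    push_cast
    ring
  simp only [h1, Finset.prod_mul_distrib]
  congr 1
  simp only [rising]
  -- What remains is one double product over `i < c` and `j < b` of `x + 2 * a + c + i + j + 1`,
  -- read by rows or by columns.
  rw [Finset.prod_comm]
  refine Finset.prod_congr rfl fun i _ => Finset.prod_congr rfl fun j _ => ?_
  push_cast
  ring

theorem det_tilingMatrix_formula (a b c : ℕ) : ∃ K : ℚ, ∀ x : ℕ,
    (tilingMatrix x a b c).det =
      K * ((∏ l ∈ Finset.range b, rising (x + (l + 1 : ℕ)) (2 * a + c)) *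
        pairProd c (2 * x + 2 * a + b + 1)) := by
  obtain ⟨K, hK⟩ := exists_det_tilingMatrix a b c
  refine ⟨K, fun x => ?_⟩
  have h := hK x
  rw [prod_rising_rearrange] at h
  have hpos : ∏ l ∈ Finset.range c, rising ((x : ℚ) + (2 * a + c + l + 1 : ℕ)) b ≠ 0 :=
    (Finset.prod_pos fun l _ => rising_pos (by positivity) b).ne'
  refine mul_right_cancel₀ hpos (h.trans ?_)
  ring

/-! ### Regrouping into the products `T` and `V` -/

theorem floor_half (c : ℕ) : ⌊((c : ℚ) + 1) / 2⌋ = (((c + 1) / 2 : ℕ) : ℤ) := by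
  rw [Int.floor_eq_iff]
  obtain ⟨k, hk | hk⟩ := Nat.even_or_odd' c
  · have : (c + 1) / 2 = k := by omega
    rw [this, hk]
    push_cast
    constructor <;> linarith
  · have : (c + 1) / 2 = k + 1 := by omega
    rw [this, hk]
    push_cast
    constructor <;> linarith

theorem T_natCast (x : ℚ) (n : ℤ) (m : ℕ) :
    T x n m = ∏ i ∈ Finset.range m, poch (x + i) (n - 2 * i) := by
  simp [T]

theorem V_natCast (x : ℚ) (n : ℤ) (m : ℕ) :
    V x n m = ∏ i ∈ Finset.range m, skipPoch (x + 2 * i) (n - 2 * i) := by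
  simp [V]

theorem T_succ (x : ℚ) (n : ℤ) (m : ℕ) :
    T x n ((m + 1 : ℕ) : ℤ) = poch x n * T (x + 1) (n - 2) m := by
  rw [T_natCast, T_natCast, Finset.prod_range_succ', mul_comm]
  congr 1
  · simp
  · refine Finset.prod_congr rfl fun i _ => ?_
    push_cast
    congr 1 <;> ring

theorem V_succ (x : ℚ) (n : ℤ) (m : ℕ) :
    V x n ((m + 1 : ℕ) : ℤ) = skipPoch x n * V (x + 2) (n - 2) m := by
  rw [V_natCast, V_natCast, Finset.prod_range_succ', mul_comm]
  congr 1
  · simp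
  · refine Finset.prod_congr rfl fun i _ => ?_
    push_cast
    congr 1 <;> ring

theorem poch_natCast (x : ℚ) (n : ℕ) : poch x n = rising x n := by
  simp [poch, rising]

theorem skipPoch_natCast (x : ℚ) (n : ℕ) :
    skipPoch x n = ∏ i ∈ Finset.range n, (x + 2 * i) := by
  simp [skipPoch]

theorem rising_half (z : ℚ) (n : ℕ) :
    rising (z / 2) n * 2 ^ n = ∏ i ∈ Finset.range n, (z + 2 * i) := by
  induction n with
  | zero => simp
  | succ n ih =>
    rw [Finset.prod_range_succ, ← ih, rising_succ]
    ring

theorem prod_even_mul_prod_odd (z : ℚ) (n : ℕ) :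
    (∏ i ∈ Finset.range (n + 1), (z + 2 * i)) * (∏ i ∈ Finset.range n, (z + 1 + 2 * i)) =
      rising z (2 * n + 1) := by
  induction n with
  | zero => simp [rising]
  | succ n ih =>
    rw [Finset.prod_range_succ, Finset.prod_range_succ (fun i : ℕ => z + 1 + 2 * (i : ℚ)),
      show 2 * (n + 1) + 1 = 2 * n + 1 + 1 + 1 by ring, rising_succ, rising_succ, ← ih]
    push_cast
    ring

/-- Splits off the pairs with `j = c`, where the definition splits off those with `i = 0`. -/
theorem pairProd_succ (c : ℕ) (z : ℚ) :
    pairProd (c + 1) z = rising (z + c) (c + 1) * pairProd c z := by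
  induction c generalizing z with
  | zero => simp [pairProd, rising]
  | succ c ih =>
    rw [pairProd, ih, pairProd]
    have h1 : rising z (c + 1 + 1) * rising (z + 2 + c) (c + 1) =
        rising z (c + 1 + 1 + (c + 1)) := by
      rw [rising_add z (c + 1 + 1)]
      congr 2
      push_cast
      ring
    have h2 : rising z (c + 1) * rising (z + (c + 1 : ℕ)) (c + 1 + 1) =
        rising z (c + 1 + (c + 1 + 1)) := (rising_add z (c + 1) (c + 1 + 1)).symm
    have e : c + 1 + 1 + (c + 1) = c + 1 + (c + 1 + 1) := by ring
    rw [e, ← h2] at h1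
    linear_combination pairProd c (z + 2) * h1

theorem pairProd_add_two (c : ℕ) (z : ℚ) :
    pairProd (c + 2) z = rising z (2 * (c + 1) + 1) * pairProd c (z + 2) := by
  rw [pairProd, pairProd_succ, ← mul_assoc, show 2 * (c + 1) + 1 = (c + 1 + 1) + (c + 1) by ring,
    rising_add z (c + 1 + 1)]
  congr 3
  push_cast
  ring

/-- The `V`- and `T`-products for odd `b`. -/
theorem exists_V_mul_T_odd (c : ℕ) : ∃ κ : ℚ, κ ≠ 0 ∧ ∀ z : ℚ,
    κ * (V (z + 1) (c - 1) ((c + 1) / 2 : ℕ) * T (z / 2) c ((c + 1) / 2 : ℕ)) = pairProd c z := by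
  induction c using Nat.twoStepInduction with
  | zero => exact ⟨1, one_ne_zero, fun z => by simp [V, T, pairProd]⟩
  | one =>
    exact ⟨2, two_ne_zero, fun z => by
      simp [V, T, pairProd, skipPoch, poch, rising]; ring⟩
  | more c ih _ =>
    obtain ⟨κ, hκ, h⟩ := ih
    -- From `c` to `c + 2`, `pairProd` gains `2 * c + 3` consecutive factors. Those at even distance
    -- from `z` form the first factor of `T`, halved `c + 2` times; those at odd distance form the
    -- first factor of `V`.
    refine ⟨κ * 2 ^ (c + 2), by positivity, fun z => ?_⟩
    have e : (c + 2 + 1) / 2 = (c + 1) / 2 + 1 := by omega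
    have e1 : ((c + 2 : ℕ) : ℤ) - 1 = ((c + 1 : ℕ) : ℤ) := by push_cast; ring
    have e2 : ((c + 1 : ℕ) : ℤ) - 2 = (c : ℤ) - 1 := by push_cast; ring
    have e3 : ((c + 2 : ℕ) : ℤ) - 2 = (c : ℤ) := by push_cast; ring
    have e4 : z / 2 + 1 = (z + 2) / 2 := by ring
    have e5 : z + 1 + 2 = z + 2 + 1 := by ring
    rw [e, V_succ, T_succ, e1, e2, e3, e4, e5, skipPoch_natCast, poch_natCast, pairProd_add_two,
      ← h, ← prod_even_mul_prod_odd, ← rising_half z]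
    ring

/-- The `V`- and `T`-products for even `b`. -/
theorem exists_V_mul_T_even (c : ℕ) : ∃ κ : ℚ, κ ≠ 0 ∧ ∀ z : ℚ,
    κ * (V z c ((c + 1) / 2 : ℕ) * T ((z + 1) / 2) (c - 1) ((c + 1) / 2 : ℕ)) =
      pairProd c z := by
  induction c using Nat.twoStepInduction with
  | zero => exact ⟨1, one_ne_zero, fun z => by simp [V, T, pairProd]⟩
  | one =>
    exact ⟨1, one_ne_zero, fun z => by
      simp [V, T, pairProd, skipPoch, poch, rising]⟩
  | more c ih _ =>
    obtain ⟨κ, hκ, h⟩ := ih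
    -- The roles are exchanged: the `c + 2` factors at even distance go to `V`, the `c + 1` others,
    -- halved, to `T`.
    refine ⟨κ * 2 ^ (c + 1), by positivity, fun z => ?_⟩
    have e : (c + 2 + 1) / 2 = (c + 1) / 2 + 1 := by omega
    have e1 : ((c + 2 : ℕ) : ℤ) - 1 = ((c + 1 : ℕ) : ℤ) := by push_cast; ring
    have e2 : ((c + 1 : ℕ) : ℤ) - 2 = (c : ℤ) - 1 := by push_cast; ring
    have e3 : ((c + 2 : ℕ) : ℤ) - 2 = (c : ℤ) := by push_cast; ring
    have e4 : (z + 1) / 2 + 1 = (z + 2 + 1) / 2 := by ring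
    rw [e, V_succ, T_succ, e1, e2, e3, e4, skipPoch_natCast, poch_natCast, pairProd_add_two,
      ← h, ← prod_even_mul_prod_odd, ← rising_half (z + 1)]
    ring

theorem rising_natCast_succ (y k : ℕ) :
    rising ((y : ℚ) + 1) k = ((y + k).factorial : ℚ) / (y.factorial : ℚ) := by
  rw [eq_div_iff (by positivity)]
  induction k with
  | zero => simp
  | succ k ih =>
    rw [rising_succ, mul_right_comm, ih, ← add_assoc, Nat.factorial_succ]
    push_cast
    ring

/-- The quotient of factorials covers both signs of the length, which the factors of `T` require
when `b` is large. -/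
theorem poch_natCast_succ (y k : ℕ) :
    poch ((y : ℚ) + 1) ((k : ℤ) - y) = (k.factorial : ℚ) / (y.factorial : ℚ) := by
  rcases le_or_gt y k with h | h
  · obtain ⟨d, rfl⟩ := Nat.exists_eq_add_of_le h
    have : ((y + d : ℕ) : ℤ) - y = (d : ℕ) := by push_cast; ring
    rw [this, poch_natCast, rising_natCast_succ]
  · obtain ⟨d, rfl⟩ := Nat.exists_eq_add_of_le h.le
    have e : -((k : ℤ) - ((k + d : ℕ) : ℤ)) = (d : ℕ) := by push_cast; ring
    have hneg : ¬ (0 ≤ (k : ℤ) - ((k + d : ℕ) : ℤ)) := by push_cast at h ⊢; omega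
    rw [poch, if_neg hneg, e, Int.toNat_natCast]
    have h1 : ∏ i ∈ Finset.range d, (((k + d : ℕ) : ℚ) + 1 - ((i : ℚ) + 1)) =
        rising ((k : ℚ) + 1) d := by
      rw [show (k : ℚ) + 1 = ((k + d : ℕ) : ℚ) - d + 1 by push_cast; ring, rising_reflect]
      refine Finset.prod_congr rfl fun i _ => ?_
      ring
    rw [h1, rising_natCast_succ, one_div_div]

/-- Both sides are quotients of products of the same factorials; the numerators only occur in
reversed order. -/
theorem T_eq_prod_rising (x a b c : ℕ) :
    T (x + 1) (2 * a + b + c - 1) b =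
      ∏ l ∈ Finset.range b, rising (x + (l + 1 : ℕ)) (2 * a + c) := by
  have h1 : ∀ i ∈ Finset.range b,
      poch ((x : ℚ) + 1 + i) (2 * a + b + c - 1 - 2 * i) =
        ((x + 2 * a + c + (b - 1 - i)).factorial : ℚ) / ((x + i).factorial : ℚ) := by
    intro i hi
    rw [Finset.mem_range] at hi
    rw [← poch_natCast_succ]
    congr 1
    · push_cast; ring
    · omega
  have h2 : ∀ l ∈ Finset.range b, rising ((x : ℚ) + (l + 1 : ℕ)) (2 * a + c) =
      ((x + 2 * a + c + l).factorial : ℚ) / ((x + l).factorial : ℚ) := by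
    intro l _
    rw [show x + 2 * a + c + l = x + l + (2 * a + c) by ring, ← rising_natCast_succ]
    congr 1
    push_cast
    ring
  rw [T_natCast, Finset.prod_congr rfl h1, Finset.prod_congr rfl h2, Finset.prod_div_distrib,
    Finset.prod_div_distrib,
    Finset.prod_range_reflect (fun l => ((x + 2 * a + c + l).factorial : ℚ))]

/-! ### The product formula -/

theorem weightedCount_regionB'_eq (x a b c : ℕ) :
    weightedCount (regionB' x a b c) zigzagWeight =
      weightedCount (regionP' c c a) zigzagWeight *
        (pairProd c (2 * x + 2 * a + b + 1) / pairProd c (2 * a + b + 1)) *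
        (T (x + 1) (2 * a + b + c - 1) b / T 1 (2 * a + b + c - 1) b) := by
  obtain ⟨K, hK⟩ := det_tilingMatrix_formula a b c
  have h0 := hK 0
  have hT := T_eq_prod_rising 0 a b c
  have h1 : pairProd c (2 * a + b + 1) ≠ 0 := (pairProd_pos c (by positivity)).ne'
  have h2 : ∏ l ∈ Finset.range b, rising (((0 : ℕ) : ℚ) + (l + 1 : ℕ)) (2 * a + c) ≠ 0 :=
    (Finset.prod_pos fun l _ => rising_pos (by positivity) _).ne'
  rw [← hT] at h0 h2
  simp only [Nat.cast_zero, mul_zero, zero_add] at h0 h2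
  rw [weightedCount_regionB', weightedCount_regionP', ← det_tilingMatrix_zero a b c, h0, hK x,
    T_eq_prod_rising x]
  field_simp

end ZigzagTiling

theorem theorem2p4 (x a b c : ℕ) :
    (Odd b →
      ZigzagTiling.weightedCount (ZigzagTiling.regionB' x a b c) ZigzagTiling.zigzagWeight =
        ZigzagTiling.weightedCount (ZigzagTiling.regionP' c c a) ZigzagTiling.zigzagWeight *
        (ZigzagTiling.V (2 * x + 2 * a + b + 2) (c - 1) ⌊((c : ℚ) + 1) / 2⌋ /
          ZigzagTiling.V (2 * a + b + 2) (c - 1) ⌊((c : ℚ) + 1) / 2⌋) *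
        ((ZigzagTiling.T (x + 1) (2 * a + b + c - 1) b *
            ZigzagTiling.T (x + a + ((b : ℚ) + 1) / 2) c ⌊((c : ℚ) + 1) / 2⌋) /
          (ZigzagTiling.T 1 (2 * a + b + c - 1) b *
            ZigzagTiling.T (a + ((b : ℚ) + 1) / 2) c ⌊((c : ℚ) + 1) / 2⌋))) ∧
    (Even b →
      ZigzagTiling.weightedCount (ZigzagTiling.regionB' x a b c) ZigzagTiling.zigzagWeight =
        ZigzagTiling.weightedCount (ZigzagTiling.regionP' c c a) ZigzagTiling.zigzagWeight *
        (ZigzagTiling.V (2 * x + 2 * a + b + 1) c ⌊((c : ℚ) + 1) / 2⌋ /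
          ZigzagTiling.V (2 * a + b + 1) c ⌊((c : ℚ) + 1) / 2⌋) *
        ((ZigzagTiling.T (x + 1) (2 * a + b + c - 1) b *
            ZigzagTiling.T (x + a + ((b : ℚ) + 2) / 2) (c - 1) ⌊((c : ℚ) + 1) / 2⌋) /
          (ZigzagTiling.T 1 (2 * a + b + c - 1) b *
            ZigzagTiling.T (a + ((b : ℚ) + 2) / 2) (c - 1) ⌊((c : ℚ) + 1) / 2⌋))) := by
  rw [ZigzagTiling.floor_half, ZigzagTiling.weightedCount_regionB'_eq]
  constructor <;> intro _
  -- Used at `z = 2x + 2a + b + 1` and at its value for `x = 0`; `κ` does not depend on `z` and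
  -- cancels in the quotient.
  · obtain ⟨κ, hκ, h⟩ := ZigzagTiling.exists_V_mul_T_odd c
    rw [← h, ← h, show (2 * x + 2 * a + b + 1 : ℚ) + 1 = 2 * x + 2 * a + b + 2 by ring,
      show (2 * a + b + 1 : ℚ) + 1 = 2 * a + b + 2 by ring,
      show (2 * x + 2 * a + b + 1 : ℚ) / 2 = x + a + ((b : ℚ) + 1) / 2 by ring,
      show (2 * a + b + 1 : ℚ) / 2 = a + ((b : ℚ) + 1) / 2 by ring,
      mul_div_mul_left _ _ hκ, mul_div_mul_comm, mul_div_mul_comm]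
    ring
  · obtain ⟨κ, hκ, h⟩ := ZigzagTiling.exists_V_mul_T_even c
    rw [← h, ← h,
      show ((2 * x + 2 * a + b + 1 : ℚ) + 1) / 2 = x + a + ((b : ℚ) + 2) / 2 by ring,
      show ((2 * a + b + 1 : ℚ) + 1) / 2 = a + ((b : ℚ) + 2) / 2 by ring,
      mul_div_mul_left _ _ hκ, mul_div_mul_comm, mul_div_mul_comm]
    ring
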